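/- **Conventions.** Variables, constants, EDB predicate symbols and IDB predicate symbols come from four disjoint countably infinite sets. A (positive) datalog program is a finite set of rules $q(\bar s)\gets p_1(\bar s_1),\dots,p_\mu(\bar s_\mu)$ whose head predicates are IDB predicates; arguments are variables or constants. A rule is safe if each head variable occurs in the body. A database $D$ is a finite set of ground EDB atoms, and $[\![q(\Pi,D)]\!]$ is the set of tuples $\bar t$ such that $q(\bar t)$ has a proof tree w.r.t. $\Pi$ and $D$. *Adornments.* An adornment $\rho$ of $q$ is a safe rule with head predicate $q$ whose body atoms have EDB predicates and whose body arguments are variables or the underscore $\_$ (each occurrence of which is a fresh existentially quantified variable). An EDB-adorned atom $q_\rho(\bar t)$ consists of an adornment $\rho$ and an instance $q(\bar t)$ of the head of $\rho$. An EDB-adorned program is a datalog program in which all IDB atoms are EDB-adorned. It is EDB-bounded if for each of its rules $R$, with head predicate $q_\rho$, and each database $D$: whenever $q_\rho(\bar t)$ is derived over $D$ by a proof tree whose topmost rule is $R$, the single rule $\rho$ derives $q(\bar t)$ over $D$. An EDB-bounded program $\Pi''$ is equivalent to $\Pi$ if $[\![q(\Pi,D)]\!]=\bigcup_\rho [\![q_\rho(\Pi'',D)]\!]$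 for every database $D$ and every IDB predicate $q$ of $\Pi$. *Width.* The integral edge-cover width $\mathsf{ew}(\rho)$ is the least number of hyperedges of the hypergraph of $\rho$ (vertices: the variables of the body; hyperedges: the variable sets of the body atoms) that cover all variables of the head of $\rho$. For an EDB-adorned program $\Pi''$, $\mathsf{ew}_{\Pi''}(q)$ is the maximum of $\mathsf{ew}(\rho)$ over the adorned predicates $q_\rho$ that head a rule of $\Pi''$. *Algorithm 1 with $g_{\sf out}$ and $h_{\sf eq}$.* Adornments that differ only by a renaming of variables are identified. Start with $\Pi'=\emptyset$ and repeat the following until nothing can be added. Take a rule $R\colon q(\bar s)\gets p_1(\bar s_1),\dots,p_\lambda(\bar s_\lambda),\mathcal E$ of $\Pi$, with $p_1,\dots,p_\lambda$ IDB and $\mathcal E$ a conjunction of EDB atoms, and adornments $\rho_1,\dots,\rho_\lambda$ such that $(p_i)_{\rho_i}$ heads a rule of $\Pi'$. Rename $\rho_1,\dots,\rho_\lambda$ apart from each other and from $R$, to $p_i(\bar v_i')\gets\mathcal B_i$, and let $\sigma$ be a most general simultaneous unifier of the pairs $(\bar s_i,\bar v_i')$, if there is one. Let $\rho_0$ be the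 rule $q(\sigma(\bar s))\gets\sigma(\mathcal B_1),\dots,\sigma(\mathcal B_\lambda),\sigma(\mathcal E)$. Let $\rho=g_{\sf out}(\rho_0)$ be obtained from $\rho_0$ by replacing each body argument that is not a head variable by $\_$, and then deleting the body atoms that have only underscores and each body atom $e(\bar t)$ for which there is another body atom $e(\bar t')$ with $t_j\in\{t'_j,\_\}$ for all $j$. Add the rule $q_\rho(\sigma(\bar s))\gets (p_1)_{\rho_1}(\sigma(\bar s_1)),\dots,(p_\lambda)_{\rho_\lambda}(\sigma(\bar s_\lambda)),\sigma(\mathcal E)$ to $\Pi'$, unless $\Pi'$ already contains it up to a renaming of variables. **Theorem.** Let $\Pi$ be a datalog program all of whose rules are safe. 1. The algorithm has an output $\Pi'$ on $\Pi$, and every output $\Pi'$ (for any order of the iterations and any choice of renamings and most general unifiers) is an EDB-bounded program equivalent to $\Pi$ such that for every IDB predicate $q$ of $\Pi$ and every EDB-bounded program $\Pi''$ equivalent to $\Pi$, $$\mathsf{ew}_{\Pi'}(q)\le \mathsf{ew}_{\Pi''}(q).$$ That is, the integral edge-cover width of $q$ in $\Pi'$ is minimal over all EDB-bounded programs equivalent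 to $\Pi$. 2. Consequently, this minimal integral width is decidable: there is a computable function that maps each pair $(\Pi,q)$, with $\Pi$ a program all of whose rules are safe and $q$ an IDB predicate of $\Pi$, to the minimum of $\mathsf{ew}_{\Pi''}(q)$ over all EDB-bounded programs $\Pi''$ equivalent to $\Pi$. -/

import Mathlib

namespace Datalog

/-! ### Datalog programs

Variables, constants, EDB predicate symbols and IDB predicate symbols are natural numbers (four
disjoint countably infinite supplies of names). Extensional and intensional predicates are kept
apart by their position in a rule. Argument tuples are lists, and atoms can only match when their
argument lists have the same length. -/

/-- A term is a variable or a constant. -/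
inductive Term where
  | var (x : ℕ)
  | const (c : ℕ)
  deriving DecidableEq

namespace Term

/-- The set of variables of a term. -/
def vars : Term → Finset ℕ
  | var x => {x}
  | const _ => ∅

/-- Application of a substitution. -/
def subst (σ : ℕ → Term) : Term → Term
  | var x => σ x
  | const c => const c

/-- The value of a term under a ground substitution. -/
def ground (θ : ℕ → ℕ) : Term → ℕ
  | var x => θ x
  | const c => c

end Term

/-- The set of variables of a tuple of terms. -/
def tupleVars : List Term → Finset ℕ
  | [] => ∅
  | t :: ts => t.vars ∪ tupleVars ts

/-- An atom `p(t₁, …, tₙ)`, with predicate symbols in `P`. -/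
structure Atom (P : Type) where
  pred : P
  args : List Term
  deriving DecidableEq

namespace Atom

variable {P : Type}

def vars (a : Atom P) : Finset ℕ := tupleVars a.args

def subst (σ : ℕ → Term) (a : Atom P) : Atom P := ⟨a.pred, a.args.map (Term.subst σ)⟩

end Atom

/-- A rule `head ← idb, edb`; the body is ordered so that the atoms with IDB predicates come first.
The IDB predicate symbols are elements of `I`, the EDB predicate symbols are natural numbers. -/
structure Rule (I : Type) where
  head : Atom I
  idb : List (Atom I)
  edb : List (Atom ℕ)
  deriving DecidableEq

namespace Rule

variable {I : Type}

/-- All variables of the body. -/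
def bodyVars (R : Rule I) : Finset ℕ :=
  tupleVars (R.idb.flatMap Atom.args ++ R.edb.flatMap Atom.args)

/-- All variables of the rule. -/
def vars (R : Rule I) : Finset ℕ := R.head.vars ∪ R.bodyVars

/-- Every variable of the head occurs in the body. -/
def Safe (R : Rule I) : Prop := R.head.vars ⊆ R.bodyVars

def subst (σ : ℕ → Term) (R : Rule I) : Rule I :=
  ⟨R.head.subst σ, R.idb.map (Atom.subst σ), R.edb.map (Atom.subst σ)⟩

/-- `R` and `S` are identical up to a renaming of variables. -/
def Variant (R S : Rule I) : Prop :=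
  ∃ π : Equiv.Perm ℕ, S = R.subst fun x => Term.var (π x)

end Rule

/-- A datalog program is a finite collection of rules. -/
abbrev Program (I : Type) := List (Rule I)

/-- Every rule of the program is safe. -/
def Program.Safe {I : Type} (Prog : Program I) : Prop := ∀ R ∈ Prog, R.Safe

/-- `q` is an IDB predicate of the program: it is the head predicate of a rule. -/
def Program.IsIDB {I : Type} (Prog : Program I) (q : I) : Prop := ∃ R ∈ Prog, R.head.pred = q

/-- A ground EDB atom. -/
abbrev Fact := ℕ × List ℕ

/-- A database instance is a finite set of ground EDB atoms. -/
abbrev Database := Finset Fact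

/-- `Derives Prog D q t`: the ground atom `q(t)` has a proof tree with respect to the program
`Prog` and the database `D`, i.e. it is in the least fixpoint of the immediate consequence
operator. -/
inductive Derives {I : Type} (Prog : Program I) (D : Database) : I → List ℕ → Prop where
  | rule (R : Rule I) (hR : R ∈ Prog) (θ : ℕ → ℕ)
      (hidb : ∀ a ∈ R.idb, Derives Prog D a.pred (a.args.map (Term.ground θ)))
      (hedb : ∀ a ∈ R.edb, (a.pred, a.args.map (Term.ground θ)) ∈ D) :
      Derives Prog D R.head.pred (R.head.args.map (Term.ground θ))

/-- The ground atom with the head predicate of `R` and arguments `t` is derived by the rule `R` when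
`Prog` is evaluated over `D`: it has a proof tree whose topmost rule application uses `R`. -/
def DerivedBy {I : Type} (Prog : Program I) (D : Database) (R : Rule I) (t : List ℕ) : Prop :=
  ∃ θ : ℕ → ℕ, t = R.head.args.map (Term.ground θ) ∧
    (∀ a ∈ R.idb, Derives Prog D a.pred (a.args.map (Term.ground θ))) ∧
    (∀ a ∈ R.edb, (a.pred, a.args.map (Term.ground θ)) ∈ D)

/-! ### Adornments -/

/-- A body atom of an adornment. Each argument is a variable (`some x`) or the underscore
(`none`). -/
structure BodyAtom where
  pred : ℕ
  args : List (Option ℕ)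
  deriving DecidableEq

/-- The named variables of a body atom. -/
def BodyAtom.vars (b : BodyAtom) : Finset ℕ := (b.args.filterMap id).toFinset

/-- An adornment `q(head) ← body`: a rule whose body atoms all have EDB predicates. It also serves
as the name of the adorned predicate `q_ρ`. -/
structure Adornment where
  pred : ℕ
  head : List Term
  body : Finset BodyAtom
  deriving DecidableEq

namespace Adornment

/-- The output variables, i.e. the variables of the head. -/
def outVars (ρ : Adornment) : Finset ℕ := tupleVars ρ.head

def bodyVars (ρ : Adornment) : Finset ℕ := ρ.body.biUnion BodyAtom.vars

def vars (ρ : Adornment) : Finset ℕ := ρ.outVars ∪ ρ.bodyVars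

def Safe (ρ : Adornment) : Prop := ρ.outVars ⊆ ρ.bodyVars

/-- Renaming of the variables of an adornment. -/
def rename (π : Equiv.Perm ℕ) (ρ : Adornment) : Adornment where
  pred := ρ.pred
  head := ρ.head.map (Term.subst fun x => Term.var (π x))
  body := ρ.body.image fun b => ⟨b.pred, b.args.map (Option.map π)⟩

/-- `ρ'` is obtained from `ρ` by a renaming of variables. -/
def Variant (ρ ρ' : Adornment) : Prop := ∃ π : Equiv.Perm ℕ, ρ' = ρ.rename π

/-- The single-rule program `ρ`, evaluated over `D`, derives the tuple `t`. Every occurrence of the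
underscore stands for its own existentially quantified variable, so it matches any value. -/
def Produces (ρ : Adornment) (D : Database) (t : List ℕ) : Prop :=
  ∃ θ : ℕ → ℕ, t = ρ.head.map (Term.ground θ) ∧
    ∀ b ∈ ρ.body, ∃ c : List ℕ, (b.pred, c) ∈ D ∧
      List.Forall₂ (fun (a : Option ℕ) (v : ℕ) => ∀ x, a = some x → θ x = v) b.args c

/-! ### Integral edge-cover width -/

/-- Vertices of the hypergraph of an adornment: the named variables, and one fresh variable for
every occurrence of the underscore (identified by the body atom and the position in it). -/
abbrev Vertex := ℕ ⊕ (BodyAtom × ℕ)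

/-- The hyperedge of a body atom: its set of variables. -/
def edge (b : BodyAtom) : Finset Vertex :=
  (b.args.zipIdx.map fun p => match p.1 with
    | some x => (Sum.inl x : Vertex)
    | none => Sum.inr (b, p.2)).toFinset

/-- The set of hyperedges of the hypergraph associated with an adornment. -/
def edges (ρ : Adornment) : Finset (Finset Vertex) := ρ.body.image edge

/-- `C` is (the support of) an integral edge cover of the output variables. -/
def IsEdgeCover (ρ : Adornment) (C : Finset (Finset Vertex)) : Prop :=
  C ⊆ ρ.edges ∧ ∀ x ∈ ρ.outVars, ∃ e ∈ C, (Sum.inl x : Vertex) ∈ e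

/-- The integral edge-cover width of an adornment: the least size of an integral edge cover of its
output variables. (Safe adornments have an edge cover, consisting of all hyperedges.) -/
noncomputable def ew (ρ : Adornment) : ℕ :=
  sInf {k | ∃ C, ρ.IsEdgeCover C ∧ C.card = k}

end Adornment

/-! ### EDB-adorned and EDB-bounded programs -/

/-- An EDB-adorned program: its IDB predicates are adorned predicates. -/
abbrev AdornedProgram := Program Adornment

/-- `a = q_ρ(t)` is an EDB-adorned atom: the adornment `ρ` is safe and `q(t)` is an instance of the
head of `ρ`. -/
def IsAdornedAtom (a : Atom Adornment) : Prop :=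
  a.pred.Safe ∧ ∃ σ : ℕ → Term, a.args = a.pred.head.map (Term.subst σ)

def AdornedProgram.WellFormed (Prog : AdornedProgram) : Prop :=
  ∀ R ∈ Prog, IsAdornedAtom R.head ∧ ∀ a ∈ R.idb, IsAdornedAtom a

/-- `Prog` is EDB-bounded: it is EDB-adorned, and every rule is bounded by the adornment of its head
predicate. -/
def AdornedProgram.EDBBounded (Prog : AdornedProgram) : Prop :=
  AdornedProgram.WellFormed Prog ∧
    ∀ R ∈ Prog, ∀ (D : Database) (t : List ℕ),
      DerivedBy Prog D R t → R.head.pred.Produces D t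

/-- A program and an adorned program are equivalent: over every database, each IDB relation of the
former is the union of all its adorned versions in the latter. -/
def Equivalent (Prog : Program ℕ) (Adorned : AdornedProgram) : Prop :=
  ∀ (D : Database) (q : ℕ), Prog.IsIDB q → ∀ t : List ℕ,
    Derives Prog D q t ↔ ∃ ρ : Adornment, ρ.pred = q ∧ Derives Adorned D ρ t

/-- The integral edge-cover width of `q` in an adorned program: the maximum of the widths of its
adorned IDB predicates `q_ρ`. -/
noncomputable def AdornedProgram.ew (Prog : AdornedProgram) (q : ℕ) : ℕ :=
  ((Prog.filter fun R => R.head.pred.pred = q).map fun R => R.head.pred.ew).foldr max 0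

/-! ### Construction of an adorned program from a given program -/

/-- `σ` makes the two tuples of each pair equal. -/
def Unifies (σ : ℕ → Term) (E : List (List Term × List Term)) : Prop :=
  ∀ p ∈ E, p.1.map (Term.subst σ) = p.2.map (Term.subst σ)

/-- `σ` is a most general unifier: every unifier is obtained from it by further instantiation. -/
def IsMGU (σ : ℕ → Term) (E : List (List Term × List Term)) : Prop :=
  Unifies σ E ∧ ∀ τ : ℕ → Term, Unifies τ E → ∃ δ : ℕ → Term, ∀ x, τ x = (σ x).subst δ

/-- A rule with EDB body atoms whose arguments are terms or the underscore (`none`). -/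
structure RawAdornment where
  pred : ℕ
  head : List Term
  body : List (ℕ × List (Option Term))

/-- Keep an argument if it is a variable in `V`, and replace it by the underscore otherwise. -/
def keepVar (V : Finset ℕ) : Option Term → Option ℕ
  | some (Term.var x) => if x ∈ V then some x else none
  | _ => none

/-- `b` imposes no more restrictions than `b'`: the predicates agree, and at each position `b` has
the same argument as `b'` or the underscore. -/
def LessRestrictive (b b' : BodyAtom) : Prop :=
  b.pred = b'.pred ∧ List.Forall₂ (fun s s' : Option ℕ => s = s' ∨ s = none) b.args b'.args

open Classical in
/-- The relaxation function `g_out`: replace every argument that is not a head variable by the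
underscore; then remove each atom that imposes less restrictions than another one, and the atoms
that have only underscores left. -/
noncomputable def gOut (r : RawAdornment) : Adornment :=
  let B : Finset BodyAtom :=
    (r.body.map fun a => (⟨a.1, a.2.map (keepVar (tupleVars r.head))⟩ : BodyAtom)).toFinset
  { pred := r.pred
    head := r.head
    body := B.filter fun b =>
      (¬ ∃ b' ∈ B, b' ≠ b ∧ LessRestrictive b b') ∧ ∃ s ∈ b.args, s ≠ none }

/-- The rule `ρ₀`, obtained from the rule `R`, the renamed adornments `ρs'` of its IDB body atoms, and
the unifier `σ`, by replacing each IDB atom by the body of its adornment and applying `σ`. -/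
noncomputable def inlined (R : Rule ℕ) (ρs' : List Adornment) (σ : ℕ → Term) : RawAdornment where
  pred := R.head.pred
  head := R.head.args.map (Term.subst σ)
  body :=
    (ρs'.flatMap fun ρ => ρ.body.toList.map fun b => (b.pred, b.args.map (Option.map σ))) ++
    R.edb.map fun a => (a.pred, a.args.map fun s => some (s.subst σ))

/-- `Candidate Prog Acc R'`: one pass through the body of the inner loop of the construction, for the
input program `Prog` and the current adorned program `Acc`, generates the adorned rule `R'`.

Adornments that only differ by a renaming of variables denote the same adorned predicate: if a
variant of the new adornment is already in use for a head predicate, then this variant is taken. -/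
def Candidate (Prog : Program ℕ) (Acc : AdornedProgram) (R' : Rule Adornment) : Prop :=
  ∃ R ∈ Prog, ∃ (ρs ρs' : List Adornment) (σ : ℕ → Term) (ρ : Adornment),
    -- each IDB body atom gets an adornment of its predicate that heads a rule of `Acc`
    List.Forall₂ (fun (a : Atom ℕ) (ρi : Adornment) =>
      ρi.pred = a.pred ∧ ∃ Ri ∈ Acc, Ri.head.pred = ρi) R.idb ρs ∧
    -- the adornments are renamed apart, from each other and from `R`
    List.Forall₂ Adornment.Variant ρs ρs' ∧
    ρs'.Pairwise (fun ρ₁ ρ₂ => Disjoint ρ₁.vars ρ₂.vars) ∧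
    (∀ ρ₁ ∈ ρs', Disjoint ρ₁.vars R.vars) ∧
    IsMGU σ ((R.idb.map Atom.args).zip (ρs'.map Adornment.head)) ∧
    -- the adornment of the new head
    (gOut (inlined R ρs' σ)).Variant ρ ∧
    (∀ S ∈ Acc, (gOut (inlined R ρs' σ)).Variant S.head.pred → S.head.pred = ρ) ∧
    -- the new rule
    R' = { head := ⟨ρ, R.head.args.map (Term.subst σ)⟩
           idb := List.zipWith
             (fun (a : Atom ℕ) (ρi : Adornment) => ⟨ρi, a.args.map (Term.subst σ)⟩) R.idb ρs
           edb := R.edb.map (Atom.subst σ) }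

/-- The membership checking function `h_eq`: the program contains the rule, up to a renaming of
variables. -/
def hEq (R' : Rule Adornment) (Acc : AdornedProgram) : Prop := ∃ S ∈ Acc, R'.Variant S

/-- A step of the construction: add a generated rule that does not pass the membership check. -/
def Step (Prog : Program ℕ) (Acc Acc' : AdornedProgram) : Prop :=
  ∃ R', Candidate Prog Acc R' ∧ ¬ hEq R' Acc ∧ Acc' = R' :: Acc

/-- `Out` is a possible result of the construction on input `Prog`, for some order of the
iterations and some choice of the renamings and most general unifiers: it is reached from the empty
program, and it is a fixpoint. -/
def IsOutput (Prog : Program ℕ) (Out : AdornedProgram) : Prop :=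
  Relation.ReflTransGen (Step Prog) [] Out ∧ ∀ R', Candidate Prog Out R' → hEq R' Out

/-! ### Encoding of programs by natural numbers, for computability -/

def Term.equivSum : Term ≃ ℕ ⊕ ℕ where
  toFun
    | .var x => .inl x
    | .const c => .inr c
  invFun
    | .inl x => .var x
    | .inr c => .const c
  left_inv t := by cases t <;> rfl
  right_inv s := by cases s <;> rfl

def Atom.equivProd (P : Type) : Atom P ≃ P × List Term where
  toFun a := (a.pred, a.args)
  invFun p := ⟨p.1, p.2⟩
  left_inv _ := rfl
  right_inv _ := rfl

def Rule.equivProd (I : Type) : Rule I ≃ Atom I × List (Atom I) × List (Atom ℕ) where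
  toFun R := (R.head, R.idb, R.edb)
  invFun p := ⟨p.1, p.2.1, p.2.2⟩
  left_inv _ := rfl
  right_inv _ := rfl

instance : Primcodable Term := Primcodable.ofEquiv (ℕ ⊕ ℕ) Term.equivSum

instance {P : Type} [Primcodable P] : Primcodable (Atom P) :=
  Primcodable.ofEquiv (P × List Term) (Atom.equivProd P)

instance {I : Type} [Primcodable I] : Primcodable (Rule I) :=
  Primcodable.ofEquiv (Atom I × List (Atom I) × List (Atom ℕ)) (Rule.equivProd I)

end Datalog

namespace Datalog

/-! ### Terms, tuples and renamings -/

/-! The minimal width has a description that mentions no adornments. Let `m` bound the names and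
lengths in the program. A cover of a tuple `t` derived over `D` is a set of facts of `D` containing
every value of `t` that is at least `m`, and `NeedsWidth` says that some derived tuple has no cover
by fewer than `w` facts. Two estimates show that the width of an output is exactly the largest
needed one.

Every equivalent EDB-bounded program supplies small covers (`exists_cover_of_derives`): the
adornment deriving `t` matches its body in `D`, and an integral edge cover of its head variables
becomes a cover of `t` that is no larger. Constants in the adornment's head could spoil this.
Shifting the values from `m` on beyond those constants is invisible to the original program and
rules it out.

Conversely, every adornment built by the algorithm is tested by a canonical database (`Canonical`),
in which the head variables take distinct fresh values and each fact containing such values is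
dominated by a body atom. These databases are glued along the unifier of a generated rule
(`Inlining.canonical`). A cover of the derived tuple then yields an edge cover that is no larger, so
the width of the adornment is needed (`Canonical.needsWidth`).

An output is bounded because relaxation only weakens a rule and the body variables of every
adornment in use are head variables (`Inlining.gOut_produces`). It is equivalent to the input
because a proof tree yields a ground unifier, hence a most general one, so that the fixpoint
contains the required rule (`IsOutput.complete`). The algorithm stops because, up to renaming, only
finitely many adornments and rules of bounded shape exist (`exists_length_bound`).

For computability, collapsing values shows that a needed width already has a witness with values at
most `2 * m` (`NeedsWidth.small`). This leaves a finite search, all of whose quantifiers range over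
primitive recursively computed lists. -/

theorem mem_tupleVars {x : ℕ} {ts : List Term} : x ∈ tupleVars ts ↔ Term.var x ∈ ts := by
  induction ts with
  | nil => simp [tupleVars]
  | cons t ts ih => cases t <;> simp [tupleVars, Term.vars, ih]

namespace Term

theorem subst_subst (σ τ : ℕ → Term) (t : Term) :
    (t.subst σ).subst τ = t.subst fun x => (σ x).subst τ := by
  cases t <;> rfl

theorem ground_subst (σ : ℕ → Term) (θ : ℕ → ℕ) (t : Term) :
    (t.subst σ).ground θ = t.ground fun x => (σ x).ground θ := by
  cases t <;> rfl

theorem subst_const (θ : ℕ → ℕ) (t : Term) :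
    (t.subst fun x => const (θ x)) = const (t.ground θ) := by
  cases t <;> rfl

theorem subst_var (t : Term) : t.subst var = t := by cases t <;> rfl

end Term

theorem map_subst_subst (σ τ : ℕ → Term) (ts : List Term) :
    (ts.map (Term.subst σ)).map (Term.subst τ) = ts.map (Term.subst fun x => (σ x).subst τ) := by
  simp [Term.subst_subst]

theorem map_ground_subst (σ : ℕ → Term) (θ : ℕ → ℕ) (ts : List Term) :
    (ts.map (Term.subst σ)).map (Term.ground θ) =
      ts.map (Term.ground fun x => (σ x).ground θ) := by
  simp [Term.ground_subst]

theorem map_subst_const (θ : ℕ → ℕ) (ts : List Term) :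
    ts.map (Term.subst fun x => Term.const (θ x)) = (ts.map (Term.ground θ)).map Term.const := by
  simp [Term.subst_const]

theorem map_ground_congr {θ θ' : ℕ → ℕ} {ts : List Term}
    (h : ∀ x, Term.var x ∈ ts → θ x = θ' x) :
    ts.map (Term.ground θ) = ts.map (Term.ground θ') := by
  refine List.map_congr_left fun t ht => ?_
  cases t with
  | var x => exact h x ht
  | const c => rfl

theorem eq_of_map_eq {α β : Type*} {f g : α → β} {l l' : List α} (h : l.map f = l'.map g) {a : α}
    (ha : a ∈ l) : ∃ a' ∈ l', f a = g a' := by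
  have : f a ∈ l'.map g := h ▸ List.mem_map_of_mem ha
  obtain ⟨a', h1, h2⟩ := List.mem_map.1 this
  exact ⟨a', h1, h2.symm⟩

/-- An injection on a finite set of variables extends to a permutation of all variables. -/
theorem exists_perm_extending (V : Finset ℕ) (f : ℕ → ℕ) (hf : Set.InjOn f V) :
    ∃ π : Equiv.Perm ℕ, ∀ x ∈ V, π x = f x := by
  induction V using Finset.induction_on with
  | empty => exact ⟨1, by simp⟩
  | insert a V ha ih =>
    obtain ⟨π, hπ⟩ := ih (hf.mono (by simp))
    refine ⟨π.trans (Equiv.swap (π a) (f a)), fun x hx => ?_⟩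
    rcases Finset.mem_insert.1 hx with rfl | hx'
    · simp
    · have hxa : x ≠ a := fun h => ha (h ▸ hx')
      rw [Equiv.trans_apply, Equiv.swap_apply_of_ne_of_ne]
      · exact hπ x hx'
      · exact fun h => hxa (π.injective h)
      · rw [hπ x hx']
        exact fun h => hxa (hf (by simp [hx']) (by simp) h)

/-- Serves to rename the variables of an adornment or a rule into an initial segment, for the
counting in the termination proof. -/
theorem exists_perm_lt (V : Finset ℕ) {N : ℕ} (h : V.card ≤ N) :
    ∃ π : Equiv.Perm ℕ, ∀ x ∈ V, π x < N := by
  classical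
  let e := V.equivFin
  obtain ⟨π, hπ⟩ := exists_perm_extending V
    (fun x => if hx : x ∈ V then (e ⟨x, hx⟩ : ℕ) else 0) (by
      intro x hx y hy hxy
      have hx' : x ∈ V := hx
      have hy' : y ∈ V := hy
      simp only [hx', hy', dif_pos] at hxy
      simpa using e.injective (Fin.ext hxy))
  refine ⟨π, fun x hx => ?_⟩
  rw [hπ x hx, dif_pos hx]
  exact (e ⟨x, hx⟩).2.trans_le h

theorem exists_perm_notMem (V A : Finset ℕ) :
    ∃ π : Equiv.Perm ℕ, ∀ x ∈ V, π x ∉ A := by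
  obtain ⟨π, hπ⟩ := exists_perm_extending V (fun x => x + (A.sup id + 1))
    (fun x _ y _ h => by simpa using h)
  refine ⟨π, fun x hx hA => ?_⟩
  have := Finset.le_sup (f := id) hA
  rw [hπ x hx] at this
  simp only [id] at this
  omega

/-! ### Body atoms, hyperedges and matching of underscores -/

theorem forall₂_match_iff {θ : ℕ → ℕ} {l : List (Option ℕ)} {d : List ℕ} :
    List.Forall₂ (fun (a : Option ℕ) (v : ℕ) => ∀ x, a = some x → θ x = v) l d ↔
      l.length = d.length ∧ ∀ (j x : ℕ), l[j]? = some (some x) → d[j]? = some (θ x) := by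
  rw [List.forall₂_iff_get]
  refine and_congr_right fun h => ⟨fun H j x hj => ?_, fun H j h1 h2 x hx => ?_⟩
  · obtain ⟨h1, h2⟩ := List.getElem?_eq_some_iff.1 hj
    have := H j h1 (h ▸ h1) x (by simpa using h2)
    rw [List.getElem?_eq_some_iff]
    exact ⟨h ▸ h1, by simpa using this.symm⟩
  · have := H j x (by rw [List.getElem?_eq_some_iff]; exact ⟨h1, by simpa using hx⟩)
    obtain ⟨h3, h4⟩ := List.getElem?_eq_some_iff.1 this
    simpa using h4.symm

theorem lessRestrictive_iff {b b' : BodyAtom} :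
    LessRestrictive b b' ↔ b.pred = b'.pred ∧ b.args.length = b'.args.length ∧
      ∀ j x : ℕ, b.args[j]? = some (some x) → b'.args[j]? = some (some x) := by
  unfold LessRestrictive
  rw [List.forall₂_iff_get]
  refine and_congr_right fun _ => and_congr_right fun h => ⟨fun H j x hj => ?_, fun H j h1 h2 => ?_⟩
  · obtain ⟨h1, h2⟩ := List.getElem?_eq_some_iff.1 hj
    have := H j h1 (h ▸ h1)
    rw [List.getElem?_eq_some_iff]
    refine ⟨h ▸ h1, ?_⟩
    simp only [List.get_eq_getElem] at this
    rcases this with h3 | h3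
    · rw [← h3, h2]
    · rw [h2] at h3; cases h3
  · simp only [List.get_eq_getElem]
    rcases hb : b.args[j] with _ | x
    · exact Or.inr rfl
    · have := H j x (by rw [List.getElem?_eq_some_iff]; exact ⟨h1, hb⟩)
      obtain ⟨h3, h4⟩ := List.getElem?_eq_some_iff.1 this
      exact Or.inl h4.symm

theorem LessRestrictive.refl (b : BodyAtom) : LessRestrictive b b :=
  lessRestrictive_iff.2 ⟨rfl, rfl, fun _ _ h => h⟩

theorem LessRestrictive.trans {a b c : BodyAtom} (h : LessRestrictive a b)
    (h' : LessRestrictive b c) : LessRestrictive a c := by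
  rw [lessRestrictive_iff] at *
  exact ⟨h.1.trans h'.1, h.2.1.trans h'.2.1, fun j x hj => h'.2.2 j x (h.2.2 j x hj)⟩

theorem LessRestrictive.antisymm {a b : BodyAtom} (h : LessRestrictive a b)
    (h' : LessRestrictive b a) : a = b := by
  rw [lessRestrictive_iff] at h h'
  obtain ⟨p, l⟩ := a
  obtain ⟨p', l'⟩ := b
  obtain ⟨h1, h2, h3⟩ := h
  obtain ⟨-, -, h3'⟩ := h'
  simp only at *
  subst h1
  congr 1
  refine List.ext_getElem h2 fun j hj hj' => ?_
  rcases hb : l[j] with _ | x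
  · rcases hb' : l'[j] with _ | x
    · rfl
    · have := h3' j x (by rw [List.getElem?_eq_some_iff]; exact ⟨hj', hb'⟩)
      obtain ⟨h5, h4⟩ := List.getElem?_eq_some_iff.1 this
      rw [hb] at h4; cases h4
  · have := h3 j x (by rw [List.getElem?_eq_some_iff]; exact ⟨hj, hb⟩)
    obtain ⟨h5, h4⟩ := List.getElem?_eq_some_iff.1 this
    exact h4.symm

/-- Body atoms, ordered by restrictiveness. -/
@[reducible]
def bodyAtomOrder : PartialOrder BodyAtom where
  le := LessRestrictive
  le_refl := LessRestrictive.refl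
  le_trans _ _ _ := LessRestrictive.trans
  le_antisymm _ _ := LessRestrictive.antisymm

/-- `gOut` deletes every atom dominated by another one. Maximal elements of the finite set guarantee
that a dominating atom survives. -/
theorem exists_maximal_lessRestrictive {B : Finset BodyAtom} {b : BodyAtom} (hb : b ∈ B) :
    ∃ b' ∈ B, LessRestrictive b b' ∧ ∀ c ∈ B, LessRestrictive b' c → c = b' := by
  let := bodyAtomOrder
  obtain ⟨b', h1, h2⟩ := B.exists_le_maximal hb
  exact ⟨b', h2.1, h1, fun c hc h => (LessRestrictive.antisymm h (h2.2 hc h)).symm⟩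

theorem BodyAtom.mem_vars {b : BodyAtom} {x : ℕ} : x ∈ b.vars ↔ some x ∈ b.args := by
  simp [BodyAtom.vars]

theorem BodyAtom.mem_vars_iff_getElem {b : BodyAtom} {x : ℕ} :
    x ∈ b.vars ↔ ∃ j : ℕ, b.args[j]? = some (some x) := by
  rw [BodyAtom.mem_vars, List.mem_iff_getElem?]

namespace Adornment

theorem inl_mem_edge {b : BodyAtom} {x : ℕ} : (Sum.inl x : Vertex) ∈ edge b ↔ x ∈ b.vars := by
  rw [BodyAtom.mem_vars_iff_getElem]
  simp only [edge, List.mem_toFinset, List.mem_map, Prod.exists, List.mem_zipIdx_iff_getElem?]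
  constructor
  · rintro ⟨a, j, h, h'⟩
    rcases a with _ | y
    · simp at h'
    · exact ⟨j, by simpa [← Sum.inl.inj h'] using h⟩
  · rintro ⟨j, h⟩
    exact ⟨some x, j, h, rfl⟩

theorem mem_outVars {ρ : Adornment} {x : ℕ} : x ∈ ρ.outVars ↔ Term.var x ∈ ρ.head := mem_tupleVars

theorem mem_bodyVars {ρ : Adornment} {x : ℕ} : x ∈ ρ.bodyVars ↔ ∃ b ∈ ρ.body, x ∈ b.vars := by
  simp [bodyVars]

theorem produces_iff {ρ : Adornment} {D : Database} {t : List ℕ} :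
    ρ.Produces D t ↔ ∃ θ : ℕ → ℕ, t = ρ.head.map (Term.ground θ) ∧
      ∀ b ∈ ρ.body, ∃ d : List ℕ, (b.pred, d) ∈ D ∧ b.args.length = d.length ∧
        ∀ j x : ℕ, b.args[j]? = some (some x) → d[j]? = some (θ x) := by
  simp only [Produces, forall₂_match_iff]

theorem rename_refl (ρ : Adornment) : ρ.rename 1 = ρ := by
  obtain ⟨p, h, B⟩ := ρ
  simp only [rename, Equiv.Perm.coe_one, id]
  congr
  · exact (List.map_congr_left fun t _ => Term.subst_var t).trans (List.map_id _)
  · have : (fun b : BodyAtom => (⟨b.pred, b.args.map (Option.map fun x => x)⟩ : BodyAtom)) = id := by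
      funext b
      simp
    exact (congrArg B.image this).trans Finset.image_id

theorem rename_rename (ρ : Adornment) (π π' : Equiv.Perm ℕ) :
    (ρ.rename π).rename π' = ρ.rename (π' * π) := by
  obtain ⟨p, h, B⟩ := ρ
  simp only [rename, Finset.image_image, map_subst_subst, Term.subst]
  congr 2
  funext b
  simp

theorem Variant.refl (ρ : Adornment) : ρ.Variant ρ := ⟨1, (rename_refl ρ).symm⟩

theorem Variant.symm {ρ ρ' : Adornment} : ρ.Variant ρ' → ρ'.Variant ρ := by
  rintro ⟨π, rfl⟩
  exact ⟨π⁻¹, by rw [rename_rename, inv_mul_cancel, rename_refl]⟩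

theorem Variant.trans {ρ ρ' ρ'' : Adornment} : ρ.Variant ρ' → ρ'.Variant ρ'' → ρ.Variant ρ'' := by
  rintro ⟨π, rfl⟩ ⟨π', rfl⟩
  exact ⟨π' * π, by rw [rename_rename]⟩

theorem mem_outVars_rename {ρ : Adornment} {π : Equiv.Perm ℕ} {x : ℕ} :
    π x ∈ (ρ.rename π).outVars ↔ x ∈ ρ.outVars := by
  simp only [mem_outVars, rename, List.mem_map]
  constructor
  · rintro ⟨t, ht, h⟩
    cases t with
    | var y => simp only [Term.subst, Term.var.injEq, EmbeddingLike.apply_eq_iff_eq] at h; exact h ▸ ht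
    | const c => simp [Term.subst] at h
  · exact fun h => ⟨_, h, rfl⟩

theorem mem_body_rename {ρ : Adornment} {π : Equiv.Perm ℕ} {b' : BodyAtom} :
    b' ∈ (ρ.rename π).body ↔ ∃ b ∈ ρ.body, (⟨b.pred, b.args.map (Option.map π)⟩ : BodyAtom) = b' := by
  simp [rename]

theorem getElem_map_option_map {π : Equiv.Perm ℕ} {l : List (Option ℕ)} {j x : ℕ} :
    (l.map (Option.map π))[j]? = some (some (π x)) ↔ l[j]? = some (some x) := by
  simp only [List.getElem?_map, Option.map_eq_some_iff]
  constructor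
  · rintro ⟨_, h1, y, rfl, h2⟩
    rw [h1, π.injective h2]
  · exact fun h => ⟨_, h, _, rfl, rfl⟩

theorem mem_vars_renamed {b : BodyAtom} {π : Equiv.Perm ℕ} {x : ℕ} :
    π x ∈ (⟨b.pred, b.args.map (Option.map π)⟩ : BodyAtom).vars ↔ x ∈ b.vars := by
  simp only [BodyAtom.mem_vars_iff_getElem, getElem_map_option_map]

theorem mem_bodyVars_rename {ρ : Adornment} {π : Equiv.Perm ℕ} {x : ℕ} :
    π x ∈ (ρ.rename π).bodyVars ↔ x ∈ ρ.bodyVars := by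
  simp only [mem_bodyVars, mem_body_rename]
  constructor
  · rintro ⟨_, ⟨b, hb, rfl⟩, h⟩
    exact ⟨b, hb, mem_vars_renamed.1 h⟩
  · rintro ⟨b, hb, h⟩
    exact ⟨_, ⟨b, hb, rfl⟩, mem_vars_renamed.2 h⟩

theorem mem_vars_rename {ρ : Adornment} {π : Equiv.Perm ℕ} {x : ℕ} :
    π x ∈ (ρ.rename π).vars ↔ x ∈ ρ.vars := by
  simp only [vars, Finset.mem_union, mem_outVars_rename, mem_bodyVars_rename]

theorem Variant.safe {ρ ρ' : Adornment} (h : ρ.Variant ρ') (hs : ρ.Safe) : ρ'.Safe := by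
  obtain ⟨π, rfl⟩ := h
  intro x hx
  obtain ⟨y, rfl⟩ := π.surjective x
  exact mem_bodyVars_rename.2 (hs (mem_outVars_rename.1 hx))

theorem Variant.bodyVars_subset {ρ ρ' : Adornment} (h : ρ.Variant ρ')
    (hs : ρ.bodyVars ⊆ ρ.outVars) : ρ'.bodyVars ⊆ ρ'.outVars := by
  obtain ⟨π, rfl⟩ := h
  intro x hx
  obtain ⟨y, rfl⟩ := π.surjective x
  exact mem_outVars_rename.2 (hs (mem_bodyVars_rename.1 hx))

theorem Variant.pred_eq {ρ ρ' : Adornment} (h : ρ.Variant ρ') : ρ'.pred = ρ.pred := by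
  obtain ⟨π, rfl⟩ := h
  rfl

theorem head_rename_ground (ρ : Adornment) (π : Equiv.Perm ℕ) (θ : ℕ → ℕ) :
    (ρ.rename π).head.map (Term.ground θ) = ρ.head.map (Term.ground fun x => θ (π x)) := by
  simp only [rename, map_ground_subst]
  rfl

theorem Variant.produces {ρ ρ' : Adornment} (h : ρ.Variant ρ') {D : Database} {t : List ℕ}
    (hp : ρ.Produces D t) : ρ'.Produces D t := by
  obtain ⟨π, rfl⟩ := h
  rw [produces_iff] at *
  obtain ⟨θ, ht, hb⟩ := hp
  refine ⟨fun x => θ (π.symm x), by simpa [head_rename_ground] using ht, fun b' hb' => ?_⟩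
  obtain ⟨b, hbm, rfl⟩ := mem_body_rename.1 hb'
  obtain ⟨c, hc, hl, hj⟩ := hb b hbm
  refine ⟨c, hc, by simpa using hl, fun j x h => ?_⟩
  obtain ⟨y, rfl⟩ := π.surjective x
  simpa using hj j y (getElem_map_option_map.1 h)

end Adornment

/-! ### The relaxation function -/

theorem keepVar_eq_some {V : Finset ℕ} {s : Option Term} {x : ℕ} :
    keepVar V s = some x ↔ s = some (Term.var x) ∧ x ∈ V := by
  rcases s with _ | _ | _
  · simp [keepVar]
  · simp only [keepVar, Option.some.injEq, Term.var.injEq]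
    split_ifs with h
    · constructor
      · intro hh; cases hh; exact ⟨rfl, h⟩
      · rintro ⟨rfl, _⟩; rfl
    · simp only [false_iff, not_and]
      rintro rfl; exact h
  · simp [keepVar]

theorem getElem_map_keepVar {V : Finset ℕ} {l : List (Option Term)} {j x : ℕ} :
    (l.map (keepVar V))[j]? = some (some x) ↔ l[j]? = some (some (Term.var x)) ∧ x ∈ V := by
  simp [keepVar_eq_some]

theorem exists_raw_of_mem_gOut {r : RawAdornment} {b : BodyAtom} (hb : b ∈ (gOut r).body) :
    ∃ a ∈ r.body, b = ⟨a.1, a.2.map (keepVar (tupleVars r.head))⟩ := by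
  simp only [gOut, Finset.mem_filter, List.mem_toFinset, List.mem_map] at hb
  obtain ⟨⟨a, h1, h2⟩, -⟩ := hb
  exact ⟨a, h1, h2.symm⟩

/-- Each raw body atom that contains a head variable is dominated by an atom of the relaxation. -/
theorem exists_mem_gOut_of_raw {r : RawAdornment} {a : ℕ × List (Option Term)} (ha : a ∈ r.body)
    {x : ℕ} (hx : some (Term.var x) ∈ a.2) (hxV : x ∈ tupleVars r.head) :
    ∃ b ∈ (gOut r).body, ∀ j y : ℕ, a.2[j]? = some (some (Term.var y)) → y ∈ tupleVars r.head →
      b.args[j]? = some (some y) := by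
  set b₀ : BodyAtom := ⟨a.1, a.2.map (keepVar (tupleVars r.head))⟩ with hb₀
  obtain ⟨b, hb, hle, hmax⟩ := exists_maximal_lessRestrictive (b := b₀)
    (B := (r.body.map fun a =>
      (⟨a.1, a.2.map (keepVar (tupleVars r.head))⟩ : BodyAtom)).toFinset)
    (by simp only [List.mem_toFinset, List.mem_map]; exact ⟨a, ha, rfl⟩)
  have key : ∀ j y : ℕ, a.2[j]? = some (some (Term.var y)) → y ∈ tupleVars r.head →
      b.args[j]? = some (some y) := fun j y h1 h2 =>
    (lessRestrictive_iff.1 hle).2.2 j y (getElem_map_keepVar.2 ⟨h1, h2⟩)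
  refine ⟨b, ?_, key⟩
  simp only [gOut, Finset.mem_filter]
  refine ⟨hb, ?_, ?_⟩
  · rintro ⟨c, hc, hne, h⟩
    exact hne (hmax c hc h)
  · obtain ⟨j, hj⟩ := List.mem_iff_getElem?.1 hx
    exact ⟨some x, List.mem_of_getElem? (key j x hj hxV), by simp⟩

theorem gOut_bodyVars_subset (r : RawAdornment) : (gOut r).bodyVars ⊆ (gOut r).outVars := by
  intro x hx
  obtain ⟨b, hb, hxb⟩ := Adornment.mem_bodyVars.1 hx
  obtain ⟨a, -, rfl⟩ := exists_raw_of_mem_gOut hb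
  obtain ⟨j, hj⟩ := BodyAtom.mem_vars_iff_getElem.1 hxb
  exact (getElem_map_keepVar.1 hj).2

theorem mem_inlined_body {R : Rule ℕ} {ρs : List Adornment} {σ : ℕ → Term}
    {a : ℕ × List (Option Term)} :
    a ∈ (inlined R ρs σ).body ↔
      (∃ ρ ∈ ρs, ∃ b ∈ ρ.body, a = (b.pred, b.args.map (Option.map σ))) ∨
      ∃ e ∈ R.edb, a = (e.pred, e.args.map fun s => some (s.subst σ)) := by
  simp only [inlined, List.mem_append, List.mem_flatMap, List.mem_map, Finset.mem_toList, eq_comm]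

/-! ### Generated rules -/

theorem forall₂_getElem {α β : Type*} {P : α → β → Prop} {l : List α} {l' : List β}
    (h : List.Forall₂ P l l') {i : ℕ} {a : α} {b : β} (ha : l[i]? = some a) (hb : l'[i]? = some b) :
    P a b := by
  obtain ⟨h1, rfl⟩ := List.getElem?_eq_some_iff.1 ha
  obtain ⟨h2, rfl⟩ := List.getElem?_eq_some_iff.1 hb
  exact (List.forall₂_iff_get.1 h).2 i h1 h2

theorem exists_getElem_of_length {α β : Type*} {l : List α} {l' : List β}
    (h : l.length = l'.length) {i : ℕ} {a : α} (ha : l[i]? = some a) : ∃ b, l'[i]? = some b := by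
  obtain ⟨h1, -⟩ := List.getElem?_eq_some_iff.1 ha
  exact ⟨l'[i], by simp⟩

/-- The relevant facts about a rule `S` generated from the rule `R` and the renamed adornments `ρs`
by the unifier `σ`; `Tr a ρ ρ'` relates an IDB body atom of `R` to its adornment in `S` and to the
renaming of it. -/
structure Inlining (Prog : Program ℕ) (Acc : AdornedProgram) (R : Rule ℕ) (ρs : List Adornment)
    (σ : ℕ → Term) (ρ : Adornment) (S : Rule Adornment)
    (Tr : Atom ℕ → Adornment → Adornment → Prop) : Prop where
  mem : R ∈ Prog
  variant : (gOut (inlined R ρs σ)).Variant ρ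
  unique : ∀ S' ∈ Acc, (gOut (inlined R ρs σ)).Variant S'.head.pred → S'.head.pred = ρ
  mgu : ∃ E, IsMGU σ E ∧ ∀ p ∈ E, ∃ a ∈ R.idb, ∃ ρ' ∈ ρs, p = (a.args, ρ'.head)
  head : S.head = ⟨ρ, R.head.args.map (Term.subst σ)⟩
  edb : S.edb = R.edb.map (Atom.subst σ)
  idb_length : S.idb.length ≤ R.idb.length
  of_atom : ∀ a ∈ R.idb, ∃ ρ₁ ρ₂, Tr a ρ₁ ρ₂
  of_adornment : ∀ ρ₂ ∈ ρs, ∃ a ρ₁, Tr a ρ₁ ρ₂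
  of_idb : ∀ z ∈ S.idb, ∃ a ρ₁ ρ₂, Tr a ρ₁ ρ₂ ∧ z = ⟨ρ₁, a.args.map (Term.subst σ)⟩
  mem_idb : ∀ {a ρ₁ ρ₂}, Tr a ρ₁ ρ₂ → a ∈ R.idb
  mem_adornments : ∀ {a ρ₁ ρ₂}, Tr a ρ₁ ρ₂ → ρ₂ ∈ ρs
  pred_eq : ∀ {a ρ₁ ρ₂}, Tr a ρ₁ ρ₂ → ρ₁.pred = a.pred
  heads : ∀ {a ρ₁ ρ₂}, Tr a ρ₁ ρ₂ → ∃ S' ∈ Acc, S'.head.pred = ρ₁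
  renamed : ∀ {a ρ₁ ρ₂}, Tr a ρ₁ ρ₂ → ρ₁.Variant ρ₂
  unified : ∀ {a ρ₁ ρ₂}, Tr a ρ₁ ρ₂ → a.args.map (Term.subst σ) = ρ₂.head.map (Term.subst σ)
  mem_idb' : ∀ {a ρ₁ ρ₂}, Tr a ρ₁ ρ₂ → (⟨ρ₁, a.args.map (Term.subst σ)⟩ : Atom Adornment) ∈ S.idb

theorem Candidate.exists_inlining {Prog : Program ℕ} {Acc : AdornedProgram} {S : Rule Adornment}
    (h : Candidate Prog Acc S) : ∃ R ρs σ ρ Tr, Inlining Prog Acc R ρs σ ρ S Tr := by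
  obtain ⟨R, hR, ρs, ρs', σ, ρ, h1, h2, -, -, h5, h6, h7, rfl⟩ := h
  have hl := h1.length_eq
  have hl' := h2.length_eq
  -- `Tr` means standing at a common position of the three lists. A relation is needed rather than a
  -- function, as equal atoms may occur with different adornments.
  refine ⟨R, ρs', σ, ρ, fun a ρ₁ ρ₂ => ∃ i : ℕ, R.idb[i]? = some a ∧ ρs[i]? = some ρ₁ ∧
    ρs'[i]? = some ρ₂, ?_⟩
  refine
    { mem := hR
      variant := h6
      unique := h7
      mgu := ⟨_, h5, ?_⟩
      head := rfl
      edb := rfl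
      idb_length := by simp
      of_atom := ?_
      of_adornment := ?_
      of_idb := ?_
      mem_idb := fun ⟨i, h, _⟩ => List.mem_of_getElem? h
      mem_adornments := fun ⟨i, _, _, h⟩ => List.mem_of_getElem? h
      pred_eq := fun ⟨i, h, h', _⟩ => (forall₂_getElem h1 h h').1
      heads := fun ⟨i, h, h', _⟩ => (forall₂_getElem h1 h h').2
      renamed := fun ⟨i, _, h, h'⟩ => forall₂_getElem h2 h h'
      unified := ?_
      mem_idb' := ?_ }
  · intro p hp
    obtain ⟨i, hi⟩ := List.mem_iff_getElem?.1 hp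
    rw [List.getElem?_zip_eq_some] at hi
    simp only [List.getElem?_map, Option.map_eq_some_iff] at hi
    obtain ⟨⟨a, ha, h3⟩, ρ', hρ', h4⟩ := hi
    exact ⟨a, List.mem_of_getElem? ha, ρ', List.mem_of_getElem? hρ', by rw [h3, h4]⟩
  · intro a ha
    obtain ⟨i, hi⟩ := List.mem_iff_getElem?.1 ha
    obtain ⟨ρ₁, h3⟩ := exists_getElem_of_length hl hi
    obtain ⟨ρ₂, h4⟩ := exists_getElem_of_length hl' h3
    exact ⟨ρ₁, ρ₂, i, hi, h3, h4⟩
  · intro ρ₂ ha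
    obtain ⟨i, hi⟩ := List.mem_iff_getElem?.1 ha
    obtain ⟨ρ₁, h3⟩ := exists_getElem_of_length hl'.symm hi
    obtain ⟨a, h4⟩ := exists_getElem_of_length hl.symm h3
    exact ⟨a, ρ₁, i, h4, h3, hi⟩
  · intro z hz
    obtain ⟨i, hi⟩ := List.mem_iff_getElem?.1 hz
    obtain ⟨a, ρ₁, h3, h4, h5⟩ := List.getElem?_zipWith_eq_some.1 hi
    obtain ⟨ρ₂, h6⟩ := exists_getElem_of_length hl' h4
    exact ⟨a, ρ₁, ρ₂, ⟨i, h3, h4, h6⟩, h5.symm⟩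
  · rintro a ρ₁ ρ₂ ⟨i, h3, h4, h6⟩
    refine h5.1 (a.args, ρ₂.head) (List.mem_of_getElem? (i := i) ?_)
    rw [List.getElem?_zip_eq_some]
    simp [h3, h6]
  · rintro a ρ₁ ρ₂ ⟨i, h3, h4, h6⟩
    refine List.mem_of_getElem? (i := i) ?_
    rw [List.getElem?_zipWith_eq_some]
    exact ⟨a, ρ₁, h3, h4, rfl⟩

/-- Programs that can be reached by the construction. -/
abbrev Reachable (Prog : Program ℕ) (Acc : AdornedProgram) : Prop :=
  Relation.ReflTransGen (Step Prog) [] Acc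

theorem Reachable.exists_candidate {Prog : Program ℕ} {Acc : AdornedProgram}
    (h : Reachable Prog Acc) {S : Rule Adornment} (hS : S ∈ Acc) :
    ∃ Acc', Reachable Prog Acc' ∧ Acc' ⊆ Acc ∧ Candidate Prog Acc' S := by
  induction h with
  | refl => simp at hS
  | tail h1 h2 ih =>
    rename_i Acc₁ Acc₂
    obtain ⟨R', hc, -, rfl⟩ := h2
    rcases List.mem_cons.1 hS with rfl | hS
    · exact ⟨Acc₁, h1, List.subset_cons_self _ _, hc⟩
    · obtain ⟨Acc', h3, h4, h5⟩ := ih hS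
      exact ⟨Acc', h3, fun x hx => List.mem_cons_of_mem _ (h4 hx), h5⟩

/-- To prove a property of all adornments in use, it suffices to show that it is inherited by
the relaxation of an inlined rule, and preserved by renamings. -/
theorem Reachable.adornment_induction {Prog : Program ℕ} {P : Adornment → Prop}
    (hvar : ∀ ρ ρ', ρ.Variant ρ' → P ρ → P ρ')
    (hstep : ∀ Acc R ρs σ ρ S Tr, Inlining Prog Acc R ρs σ ρ S Tr → (∀ ρ' ∈ ρs, P ρ') →
      P (gOut (inlined R ρs σ)))
    {Acc : AdornedProgram} (h : Reachable Prog Acc) : ∀ S ∈ Acc, P S.head.pred := by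
  induction h with
  | refl => simp
  | tail h1 h2 ih =>
    obtain ⟨R', hc, -, rfl⟩ := h2
    intro S hS
    rcases List.mem_cons.1 hS with rfl | hS
    · obtain ⟨R, ρs, σ, ρ, Tr, hin⟩ := hc.exists_inlining
      rw [hin.head]
      refine hvar _ _ hin.variant (hstep _ _ _ _ _ _ _ hin fun ρ₂ hρ₂ => ?_)
      obtain ⟨a, ρ₁, htr⟩ := hin.of_adornment ρ₂ hρ₂
      obtain ⟨S', hS', rfl⟩ := hin.heads htr
      exact hvar _ _ (hin.renamed htr) (ih _ hS')
    · exact ih S hS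

/-- A generated rule must reuse a variant already in use as a head predicate. Hence each renaming
class keeps a single representative throughout the run. -/
theorem Reachable.variant_unique {Prog : Program ℕ} {Acc : AdornedProgram}
    (h : Reachable Prog Acc) : ∀ S ∈ Acc, ∀ S' ∈ Acc, S.head.pred.Variant S'.head.pred →
      S.head.pred = S'.head.pred := by
  induction h with
  | refl => simp
  | @tail Acc₁ _ h1 h2 ih =>
    obtain ⟨R', hc, -, rfl⟩ := h2
    obtain ⟨R, ρs, σ, ρ, Tr, hin⟩ := hc.exists_inlining
    have key : ∀ S ∈ Acc₁, ρ.Variant S.head.pred → S.head.pred = ρ := fun S hS hv =>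
      hin.unique S hS (hin.variant.trans hv)
    have hρ : R'.head.pred = ρ := by rw [hin.head]
    intro S hS S' hS' hv
    rcases List.mem_cons.1 hS with rfl | hS₁ <;> rcases List.mem_cons.1 hS' with rfl | hS₁'
    · rfl
    · rw [hρ] at hv ⊢
      exact (key S' hS₁' hv).symm
    · rw [hρ] at hv ⊢
      exact key S hS₁ hv.symm
    · exact ih S hS₁ S' hS₁' hv

theorem Reachable.idb_heads {Prog : Program ℕ} {Acc : AdornedProgram}
    (h : Reachable Prog Acc) {S : Rule Adornment} (hS : S ∈ Acc) {z : Atom Adornment}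
    (hz : z ∈ S.idb) : ∃ S' ∈ Acc, S'.head.pred = z.pred := by
  obtain ⟨Acc', -, hsub, hc⟩ := h.exists_candidate hS
  obtain ⟨R, ρs, σ, ρ, Tr, hin⟩ := hc.exists_inlining
  obtain ⟨a, ρ₁, ρ₂, htr, rfl⟩ := hin.of_idb z hz
  obtain ⟨S', hS', h'⟩ := hin.heads htr
  exact ⟨S', hsub hS', h'⟩

/-- Safe adornments all of whose body variables are output variables. -/
def Adornment.Tight (ρ : Adornment) : Prop := ρ.Safe ∧ ρ.bodyVars ⊆ ρ.outVars

theorem Rule.Safe.exists_atom {I : Type} {R : Rule I} (h : R.Safe) {x : ℕ}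
    (hx : Term.var x ∈ R.head.args) :
    (∃ a ∈ R.idb, Term.var x ∈ a.args) ∨ ∃ a ∈ R.edb, Term.var x ∈ a.args := by
  have := h (mem_tupleVars.2 hx)
  simpa [Rule.bodyVars, mem_tupleVars] using this

/-- A head variable after unification is `σ y` for a head variable `y` of `R`, and safety places `y`
in a body atom. If that atom is an IDB atom, the unifier equates `y` with a head variable of its
adornment, which occurs in the adornment's body by safety of the latter. -/
theorem Inlining.gOut_tight {Prog : Program ℕ} (hsafe : Prog.Safe) {Acc : AdornedProgram}
    {R : Rule ℕ} {ρs : List Adornment} {σ : ℕ → Term} {ρ : Adornment} {S : Rule Adornment}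
    {Tr : Atom ℕ → Adornment → Adornment → Prop} (h : Inlining Prog Acc R ρs σ ρ S Tr)
    (hρs : ∀ ρ' ∈ ρs, ρ'.Tight) : (gOut (inlined R ρs σ)).Tight := by
  refine ⟨fun x hx => ?_, gOut_bodyVars_subset _⟩
  have hxV : x ∈ tupleVars (inlined R ρs σ).head := hx
  suffices ∃ a ∈ (inlined R ρs σ).body, some (Term.var x) ∈ a.2 by
    obtain ⟨a, ha, hxa⟩ := this
    obtain ⟨b, hb, hj⟩ := exists_mem_gOut_of_raw ha hxa hxV
    obtain ⟨j, hj'⟩ := List.mem_iff_getElem?.1 hxa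
    exact Adornment.mem_bodyVars.2
      ⟨b, hb, BodyAtom.mem_vars_iff_getElem.2 ⟨j, hj j x hj' hxV⟩⟩
  obtain ⟨s, hs, hsx⟩ := List.mem_map.1 (mem_tupleVars.1 hxV)
  cases s with
  | const c => simp [Term.subst] at hsx
  | var y =>
    rcases (hsafe R h.mem).exists_atom hs with ⟨a, ha, hya⟩ | ⟨e, he, hye⟩
    · obtain ⟨ρ₁, ρ₂, htr⟩ := h.of_atom a ha
      obtain ⟨t, ht, hyt⟩ := eq_of_map_eq (h.unified htr) hya
      rw [hsx] at hyt
      cases t with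
      | const c => simp [Term.subst] at hyt
      | var z =>
        obtain ⟨b, hb, hzb⟩ := Adornment.mem_bodyVars.1
          ((hρs _ (h.mem_adornments htr)).1 (Adornment.mem_outVars.2 ht))
        refine ⟨_, mem_inlined_body.2 (Or.inl ⟨ρ₂, h.mem_adornments htr, b, hb, rfl⟩), ?_⟩
        exact List.mem_map.2 ⟨some z, BodyAtom.mem_vars.1 hzb, by simpa [Term.subst] using hyt.symm⟩
    · exact ⟨_, mem_inlined_body.2 (Or.inr ⟨e, he, rfl⟩),
        List.mem_map.2 ⟨_, hye, congrArg some hsx⟩⟩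

theorem Reachable.tight {Prog : Program ℕ} (hsafe : Prog.Safe) {Acc : AdornedProgram}
    (h : Reachable Prog Acc) : ∀ S ∈ Acc, S.head.pred.Tight :=
  h.adornment_induction (fun _ _ hv hT => ⟨hv.safe hT.1, hv.bodyVars_subset hT.2⟩)
    fun _ _ _ _ _ _ _ hin hρs => hin.gOut_tight hsafe hρs

/-! ### Boundedness of the constructed program -/

/-- The adornments of the body atoms come with their own assignments, which might disagree with `θ`.
Since their body variables are head variables, the unified head tuples force each such assignment to
be `σ` followed by `θ` on all variables that matter. -/
theorem Inlining.gOut_produces {Prog : Program ℕ} {Acc : AdornedProgram}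
    {R : Rule ℕ} {ρs : List Adornment} {σ : ℕ → Term} {ρ : Adornment} {S : Rule Adornment}
    {Tr : Atom ℕ → Adornment → Adornment → Prop} (h : Inlining Prog Acc R ρs σ ρ S Tr)
    (hρs : ∀ ρ' ∈ ρs, ρ'.Tight) {D : Database} {θ : ℕ → ℕ}
    (hidb : ∀ a ρ₁ ρ₂, Tr a ρ₁ ρ₂ →
      ρ₂.Produces D ((a.args.map (Term.subst σ)).map (Term.ground θ)))
    (hedb : ∀ e ∈ R.edb, (e.pred, (e.args.map (Term.subst σ)).map (Term.ground θ)) ∈ D) :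
    (gOut (inlined R ρs σ)).Produces D ((R.head.args.map (Term.subst σ)).map (Term.ground θ)) := by
  rw [Adornment.produces_iff]
  refine ⟨θ, rfl, fun b hb => ?_⟩
  obtain ⟨a, ha, rfl⟩ := exists_raw_of_mem_gOut hb
  rcases mem_inlined_body.1 ha with ⟨ρ₂, hρ₂, b, hb', rfl⟩ | ⟨e, he, rfl⟩
  · obtain ⟨a, ρ₁, htr⟩ := h.of_adornment ρ₂ hρ₂
    obtain ⟨θ₂, ht, hθ₂⟩ := Adornment.produces_iff.1 (hidb _ _ _ htr)
    obtain ⟨d, hd, hl, hj⟩ := hθ₂ b hb'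
    refine ⟨d, hd, by simpa using hl, fun j x hx => ?_⟩
    obtain ⟨hx1, -⟩ := getElem_map_keepVar.1 hx
    simp only [List.getElem?_map, Option.map_eq_some_iff] at hx1
    obtain ⟨_, hy, y, rfl, hyx⟩ := hx1
    rw [hj j y hy]
    have hyout : y ∈ ρ₂.outVars := (hρs ρ₂ hρ₂).2
      (Adornment.mem_bodyVars.2 ⟨b, hb', BodyAtom.mem_vars_iff_getElem.2 ⟨j, hy⟩⟩)
    rw [h.unified htr, map_ground_subst] at ht
    have := List.map_inj_left.1 ht _ (Adornment.mem_outVars.1 hyout)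
    simp only [Term.ground, hyx] at this
    rw [← this]
  · refine ⟨_, hedb e he, by simp, fun j x hx => ?_⟩
    obtain ⟨hx1, -⟩ := getElem_map_keepVar.1 hx
    simp only [List.getElem?_map, Option.map_eq_some_iff, Option.some.injEq] at hx1
    obtain ⟨s, hs, hsx⟩ := hx1
    simp [hs, hsx, Term.ground]

theorem Derives.exists_rule {I : Type} {Prog : Program I} {D : Database} {q : I} {t : List ℕ}
    (h : Derives Prog D q t) : ∃ R ∈ Prog, R.head.pred = q ∧ DerivedBy Prog D R t := by
  cases h with
  | rule R hR θ h1 h2 => exact ⟨R, hR, rfl, θ, rfl, h1, h2⟩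

theorem Reachable.derives_produces {Prog : Program ℕ} (hsafe : Prog.Safe) {Out : AdornedProgram}
    (h : Reachable Prog Out) {D : Database} :
    ∀ {S : Rule Adornment}, S ∈ Out → ∀ {θ : ℕ → ℕ},
      (∀ z ∈ S.idb, z.pred.Produces D (z.args.map (Term.ground θ))) →
      (∀ e ∈ S.edb, (e.pred, e.args.map (Term.ground θ)) ∈ D) →
      S.head.pred.Produces D (S.head.args.map (Term.ground θ)) := by
  intro S hS θ hidb hedb
  obtain ⟨Acc, hAcc, hsub, hc⟩ := h.exists_candidate hS
  obtain ⟨R, ρs, σ, ρ, Tr, hin⟩ := hc.exists_inlining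
  rw [hin.head]
  refine hin.variant.produces (hin.gOut_produces (fun ρ₂ hρ₂ => ?_) (fun a ρ₁ ρ₂ htr => ?_) ?_)
  · obtain ⟨a, ρ₁, htr⟩ := hin.of_adornment ρ₂ hρ₂
    obtain ⟨S', hS', rfl⟩ := hin.heads htr
    have := hAcc.tight hsafe S' hS'
    exact ⟨(hin.renamed htr).safe this.1, (hin.renamed htr).bodyVars_subset this.2⟩
  · exact (hin.renamed htr).produces (hidb _ (hin.mem_idb' htr))
  · intro e he
    exact hedb _ (hin.edb ▸ List.mem_map_of_mem (f := Atom.subst σ) he)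

theorem Reachable.produces_of_derives {Prog : Program ℕ} (hsafe : Prog.Safe) {Out : AdornedProgram}
    (h : Reachable Prog Out) {D : Database} {ρ : Adornment} {t : List ℕ}
    (hd : Derives Out D ρ t) : ρ.Produces D t := by
  induction hd with
  | rule S hS θ hidb hedb ih => exact h.derives_produces hsafe hS ih hedb

theorem Adornment.Variant.exists_instance {ρ ρ' : Adornment} (h : ρ.Variant ρ') (σ : ℕ → Term) :
    ∃ τ : ℕ → Term, ρ.head.map (Term.subst σ) = ρ'.head.map (Term.subst τ) := by
  obtain ⟨π, rfl⟩ := h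
  refine ⟨fun x => σ (π.symm x), ?_⟩
  simp only [Adornment.rename, map_subst_subst]
  simp [Term.subst]

theorem Reachable.wellFormed {Prog : Program ℕ} (hsafe : Prog.Safe) {Out : AdornedProgram}
    (h : Reachable Prog Out) : AdornedProgram.WellFormed Out := by
  intro S hS
  obtain ⟨Acc, hAcc, hsub, hc⟩ := h.exists_candidate hS
  obtain ⟨R, ρs, σ, ρ, Tr, hin⟩ := hc.exists_inlining
  refine ⟨⟨(h.tight hsafe S hS).1, ?_⟩, fun z hz => ?_⟩
  · rw [hin.head]
    obtain ⟨τ, hτ⟩ := hin.variant.exists_instance Term.var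
    refine ⟨τ, hτ ▸ ?_⟩
    exact ((List.map_congr_left fun t _ => Term.subst_var t).trans (List.map_id _)).symm
  · obtain ⟨S', hS', h'⟩ := h.idb_heads hS hz
    refine ⟨h' ▸ (h.tight hsafe S' hS').1, ?_⟩
    obtain ⟨a, ρ₁, ρ₂, htr, rfl⟩ := hin.of_idb z hz
    obtain ⟨τ, hτ⟩ := (hin.renamed htr).symm.exists_instance σ
    exact ⟨τ, (hin.unified htr).trans hτ⟩

theorem Reachable.edbBounded {Prog : Program ℕ} (hsafe : Prog.Safe) {Out : AdornedProgram}
    (h : Reachable Prog Out) : AdornedProgram.EDBBounded Out := by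
  refine ⟨h.wellFormed hsafe, ?_⟩
  rintro S hS D t ⟨θ, rfl, hidb, hedb⟩
  exact h.derives_produces hsafe hS (fun z hz => h.produces_of_derives hsafe (hidb z hz)) hedb

/-! ### Most general unifiers -/

/-- Without function symbols no unification algorithm is required: two terms are identified exactly
when all unifiers agree on them, and each class is mapped to a chosen representative. Every unifier
factors through this choice, with itself as the further instantiation. -/
theorem exists_isMGU {E : List (List Term × List Term)} (h : ∃ τ, Unifies τ E) :
    ∃ σ, IsMGU σ E := by
  classical
  obtain ⟨τ₀, h₀⟩ := h
  -- The vector of values of a term under all unifiers. `G` picks a representative of each vector: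
  -- the constant, if the vector is constantly one, and otherwise the least variable having that
  -- vector.
  let v : Term → ({τ // Unifies τ E} → Term) := fun t τ => t.subst τ.1
  obtain ⟨G, hG, hG'⟩ : ∃ G : ({τ // Unifies τ E} → Term) → Term,
      (∀ c, G (fun _ => .const c) = .const c) ∧
        ∀ (x : ℕ) (τ : {τ // Unifies τ E}), τ.1 x = (G (v (.var x))).subst τ.1 := by
    refine ⟨fun w => if h : ∃ c, w = fun _ => .const c then .const h.choose
      else .var (sInf {y | v (.var y) = w}), fun c => ?_, fun x τ => ?_⟩
    · have h : ∃ c', (fun _ : {τ // Unifies τ E} => Term.const c) = fun _ => Term.const c' :=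
        ⟨c, rfl⟩
      simp only [dif_pos h]
      exact (congrFun h.choose_spec ⟨τ₀, h₀⟩).symm
    · dsimp only
      split_ifs with h
      · exact congrFun h.choose_spec τ
      · have := Nat.sInf_mem (s := {y | v (.var y) = v (.var x)}) ⟨x, rfl⟩
        exact (congrFun this τ).symm
  have key : ∀ t : Term, t.subst (fun x => G (v (.var x))) = G (v t) := by
    rintro (x | c)
    · rfl
    · exact (hG c).symm
  refine ⟨fun x => G (v (.var x)), fun p hp => ?_, fun τ hτ => ⟨τ, fun x => hG' x ⟨τ, hτ⟩⟩⟩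
  have hlen : p.1.length = p.2.length := by simpa using congrArg List.length (h₀ p hp)
  refine List.ext_getElem (by simpa using hlen) fun j h1 h2 => ?_
  simp only [List.getElem_map, key]
  congr 1
  funext τ
  have := List.getElem_of_eq (τ.2 p hp) (i := j) (by simpa using h1)
  simpa using this

/-- A most general unifier does not introduce new constants. -/
theorem IsMGU.const_mem {E : List (List Term × List Term)} {σ : ℕ → Term} (h : IsMGU σ E)
    {x c : ℕ} (hx : σ x = .const c) : ∃ p ∈ E, Term.const c ∈ p.1 ∨ Term.const c ∈ p.2 := by
  by_contra! hc
  -- Replacing a foreign constant `c` by `c + 1` in the values of `σ` gives another unifier. It is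
  -- not an instance of `σ`, because instantiation fixes constants.
  let f : Term → Term := fun t => if t = .const c then .const (c + 1) else t
  have key : ∀ ts : List Term, Term.const c ∉ ts →
      ts.map (Term.subst fun y => f (σ y)) = (ts.map (Term.subst σ)).map f := by
    intro ts hts
    rw [List.map_map]
    refine List.map_congr_left fun t ht => ?_
    cases t with
    | var y => rfl
    | const d =>
      have : d ≠ c := fun h => hts (h ▸ ht)
      simp [Term.subst, f, this]
  obtain ⟨δ, hδ⟩ := h.2 (fun y => f (σ y)) fun p hp => by
    rw [key _ (hc p hp).1, key _ (hc p hp).2, h.1 p hp]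
  have := hδ x
  simp [hx, f, Term.subst] at this

/-! ### Equivalence of the constructed program -/

theorem Reachable.sound {Prog : Program ℕ} {Out : AdornedProgram}
    (h : Reachable Prog Out) {D : Database} {ρ : Adornment} {t : List ℕ}
    (hd : Derives Out D ρ t) : Derives Prog D ρ.pred t := by
  induction hd with
  | rule S hS θ hidb hedb ih =>
    obtain ⟨Acc, hAcc, hsub, hc⟩ := h.exists_candidate hS
    obtain ⟨R, ρs, σ, ρ, Tr, hin⟩ := hc.exists_inlining
    rw [hin.head, hin.variant.pred_eq, map_ground_subst]
    refine Derives.rule R hin.mem _ (fun a ha => ?_) (fun e he => ?_)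
    · obtain ⟨ρ₁, ρ₂, htr⟩ := hin.of_atom a ha
      have := ih _ (hin.mem_idb' htr)
      rwa [map_ground_subst, hin.pred_eq htr] at this
    · have := hedb _ (hin.edb ▸ List.mem_map_of_mem (f := Atom.subst σ) he)
      simp only [Atom.subst, map_ground_subst] at this
      exact this

theorem exists_forall₂ {α β : Type*} {P : α → β → Prop} {l : List α} (h : ∀ a ∈ l, ∃ b, P a b) :
    ∃ l', List.Forall₂ P l l' := by
  induction l with
  | nil => exact ⟨[], .nil⟩
  | cons a l ih =>
    obtain ⟨b, hb⟩ := h a (by simp)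
    obtain ⟨l', hl'⟩ := ih fun a ha => h a (by simp [ha])
    exact ⟨b :: l', .cons hb hl'⟩

/-- Adornments can be renamed apart, together with matches of their heads. -/
theorem exists_renamed_apart {ts : List (List ℕ)} {ρs : List Adornment}
    (h : List.Forall₂ (fun t ρ => ∃ θ, t = ρ.head.map (Term.ground θ)) ts ρs) :
    ∀ (A : Finset ℕ) (θ : ℕ → ℕ), ∃ (ρs' : List Adornment) (θ' : ℕ → ℕ),
      List.Forall₂ Adornment.Variant ρs ρs' ∧
      ρs'.Pairwise (fun ρ₁ ρ₂ => Disjoint ρ₁.vars ρ₂.vars) ∧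
      (∀ ρ ∈ ρs', Disjoint ρ.vars A) ∧ (∀ x ∈ A, θ' x = θ x) ∧
      List.Forall₂ (fun t ρ => t = ρ.head.map (Term.ground θ')) ts ρs' := by
  induction h with
  | nil => exact fun A θ => ⟨[], θ, .nil, .nil, by simp, fun _ _ => rfl, .nil⟩
  | @cons t ρ ts ρs h1 h2 ih =>
    intro A θ
    obtain ⟨θ₁, rfl⟩ := h1
    obtain ⟨π, hπ⟩ := exists_perm_notMem ρ.vars A
    have hdisj : ∀ x ∈ (ρ.rename π).vars, x ∉ A := fun x hx => by
      obtain ⟨y, rfl⟩ := π.surjective x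
      exact hπ y (Adornment.mem_vars_rename.1 hx)
    -- The variables just used join the forbidden set, and their values join the assignment, so that
    -- a single assignment matches all renamed heads.
    obtain ⟨ρs', θ', h3, h4, h5, h6, h7⟩ := ih (A ∪ (ρ.rename π).vars)
      (fun x => if x ∈ A then θ x else θ₁ (π.symm x))
    refine ⟨ρ.rename π :: ρs', θ', .cons ⟨π, rfl⟩ h3, .cons (fun ρ' hρ' => ?_) h4, ?_, ?_,
      .cons ?_ h7⟩
    · exact (Finset.disjoint_union_right.1 (h5 ρ' hρ')).2.symm
    · intro ρ' hρ'
      rcases List.mem_cons.1 hρ' with rfl | hρ'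
      · exact Finset.disjoint_left.2 hdisj
      · exact (Finset.disjoint_union_right.1 (h5 ρ' hρ')).1
    · intro x hx
      rw [h6 x (by simp [hx]), if_pos hx]
    · rw [Adornment.head_rename_ground]
      refine map_ground_congr fun x hx => ?_
      have hv : π x ∈ (ρ.rename π).vars := Adornment.mem_vars_rename.2
        (Finset.mem_union_left _ (Adornment.mem_outVars.2 hx))
      rw [h6 _ (by simp [hv]), if_neg (hdisj _ hv)]
      simp

theorem Rule.Variant.derives {I : Type} {S S' : Rule I} (h : S.Variant S') {Prog : Program I}
    (hS' : S' ∈ Prog) {D : Database} {θ : ℕ → ℕ}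
    (hidb : ∀ a ∈ S.idb, Derives Prog D a.pred (a.args.map (Term.ground θ)))
    (hedb : ∀ a ∈ S.edb, (a.pred, a.args.map (Term.ground θ)) ∈ D) :
    Derives Prog D S.head.pred (S.head.args.map (Term.ground θ)) := by
  obtain ⟨π, rfl⟩ := h
  have key : ∀ ts : List Term, (ts.map (Term.subst fun x => .var (π x))).map
      (Term.ground fun x => θ (π.symm x)) = ts.map (Term.ground θ) := by
    intro ts
    rw [map_ground_subst]
    exact map_ground_congr fun x _ => by simp [Term.ground]
  have := Derives.rule (D := D) _ hS' (fun x => θ (π.symm x)) ?_ ?_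
  · simpa only [Rule.subst, Atom.subst, key] using this
  · intro a ha
    obtain ⟨b, hb, rfl⟩ := List.mem_map.1 ha
    simpa only [Atom.subst, key] using hidb b hb
  · intro a ha
    obtain ⟨b, hb, rfl⟩ := List.mem_map.1 ha
    simpa only [Atom.subst, key] using hedb b hb

theorem forall₂_imp_mem {α β : Type*} {P Q : α → β → Prop} {l : List α} {l' : List β}
    (h : List.Forall₂ P l l') (H : ∀ a ∈ l, ∀ b ∈ l', P a b → Q a b) : List.Forall₂ Q l l' := by
  induction h with
  | nil => exact .nil
  | cons h1 h2 ih =>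
    exact .cons (H _ (by simp) _ (by simp) h1)
      (ih fun a ha b hb => H a (by simp [ha]) b (by simp [hb]))

theorem forall_mem_zipWith {α β γ : Type*} {f : α → β → γ} {P : γ → Prop} {l : List α} {l' : List β}
    (h : List.Forall₂ (fun a b => P (f a b)) l l') : ∀ c ∈ List.zipWith f l l', P c := by
  induction h with
  | nil => simp
  | cons h1 h2 ih => simpa using ⟨h1, ih⟩

/-- By induction on the proof tree, each IDB body atom is derived in an adorned version, whose head
therefore matches the ground atom. Once the adornments are renamed apart, these matches form one
ground unifier. The rule generated from a most general unifier is in the fixpoint up to renaming and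
specialises to the given rule application. -/
theorem IsOutput.complete {Prog : Program ℕ} (hsafe : Prog.Safe) {Out : AdornedProgram}
    (h : IsOutput Prog Out) {D : Database} {q : ℕ} {t : List ℕ} (hd : Derives Prog D q t) :
    ∃ ρ : Adornment, ρ.pred = q ∧ Derives Out D ρ t := by
  classical
  have hreach : Reachable Prog Out := h.1
  induction hd with
  | rule R hR θ hidb hedb ih =>
    obtain ⟨ρs, hρs⟩ := exists_forall₂ ih
    obtain ⟨ρs', θ', h1, h2, h3, h4, h5⟩ := exists_renamed_apart
      (ts := R.idb.map fun a => a.args.map (Term.ground θ)) (ρs := ρs)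
      (List.forall₂_map_left_iff.2 (hρs.imp fun a ρ h => by
        obtain ⟨θ₁, h1, -⟩ := hreach.produces_of_derives hsafe h.2
        exact ⟨θ₁, h1⟩)) R.vars θ
    have hθ : ∀ ts : List Term, (∀ x, Term.var x ∈ ts → x ∈ R.vars) →
        ts.map (Term.ground θ') = ts.map (Term.ground θ) := fun ts hts =>
      map_ground_congr fun x hx => h4 x (hts x hx)
    have hhead : ∀ x, Term.var x ∈ R.head.args → x ∈ R.vars := fun x hx =>
      Finset.mem_union_left _ (mem_tupleVars.2 hx)
    have hidbv : ∀ a ∈ R.idb, ∀ x, Term.var x ∈ a.args → x ∈ R.vars := fun a ha x hx =>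
      Finset.mem_union_right _ (mem_tupleVars.2 (by
        simp only [List.mem_append, List.mem_flatMap]
        exact Or.inl ⟨a, ha, hx⟩))
    have hedbv : ∀ a ∈ R.edb, ∀ x, Term.var x ∈ a.args → x ∈ R.vars := fun a ha x hx =>
      Finset.mem_union_right _ (mem_tupleVars.2 (by
        simp only [List.mem_append, List.mem_flatMap]
        exact Or.inr ⟨a, ha, hx⟩))
    have hunif : Unifies (fun x => .const (θ' x))
        ((R.idb.map Atom.args).zip (ρs'.map Adornment.head)) := by
      intro p hp
      obtain ⟨i, hi⟩ := List.mem_iff_getElem?.1 hp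
      rw [List.getElem?_zip_eq_some] at hi
      simp only [List.getElem?_map, Option.map_eq_some_iff] at hi
      obtain ⟨⟨a, ha, h6⟩, ρ', hρ', h7⟩ := hi
      rw [map_subst_const, map_subst_const, ← h6, ← h7,
        hθ _ (hidbv a (List.mem_of_getElem? ha)),
        forall₂_getElem (List.forall₂_map_left_iff.1 h5) ha hρ']
    obtain ⟨σ, hσ⟩ := exists_isMGU ⟨_, hunif⟩
    obtain ⟨δ, hδ⟩ := hσ.2 _ hunif
    -- The default 0 is harmless: a variable occurring in some `σ x` is sent by `δ` to a constant.
    let δ' : ℕ → ℕ := fun x => match δ x with | .const c => c | .var _ => 0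
    have hground : ∀ ts : List Term, (ts.map (Term.subst σ)).map (Term.ground δ') =
        ts.map (Term.ground θ') := by
      intro ts
      rw [map_ground_subst]
      refine map_ground_congr fun x _ => ?_
      have := hδ x
      rcases hx : σ x with y | c
      · rw [hx] at this
        simp only [Term.subst] at this
        simp [Term.ground, δ', ← this]
      · rw [hx] at this
        simpa [Term.subst, Term.ground] using this.symm
    -- A variant already in use is taken if there is one, and `variant_unique` makes it the only
    -- choice.
    obtain ⟨ρ, hρ, hρ'⟩ : ∃ ρ, (gOut (inlined R ρs' σ)).Variant ρ ∧
        ∀ S ∈ Out, (gOut (inlined R ρs' σ)).Variant S.head.pred → S.head.pred = ρ := by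
      by_cases hS : ∃ S ∈ Out, (gOut (inlined R ρs' σ)).Variant S.head.pred
      · obtain ⟨S, hS, hv⟩ := hS
        exact ⟨_, hv, fun S' hS' hv' =>
          hreach.variant_unique S' hS' S hS (hv'.symm.trans hv)⟩
      · exact ⟨_, .refl _, fun S hS' hv => absurd ⟨S, hS', hv⟩ hS⟩
    obtain ⟨S, hS, hv⟩ := h.2 _ ⟨R, hR, ρs, ρs', σ, ρ,
      hρs.imp (fun a ρ h => ⟨h.1, h.2.exists_rule.imp fun S hS => ⟨hS.1, hS.2.1⟩⟩),
      h1, h2, h3, hσ, hρ, hρ', rfl⟩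
    refine ⟨ρ, hρ.pred_eq, ?_⟩
    have := hv.derives hS (D := D) (θ := δ') ?_ ?_
    · rwa [hground, hθ _ hhead] at this
    · refine forall_mem_zipWith (forall₂_imp_mem hρs fun a ha ρ _ hd => ?_)
      rw [hground, hθ _ (hidbv a ha)]
      exact hd.2
    · intro e' he'
      obtain ⟨e, he, rfl⟩ := List.mem_map.1 he'
      simp only [Atom.subst]
      rw [hground, hθ _ (hedbv e he)]
      exact hedb e he

theorem IsOutput.equivalent {Prog : Program ℕ} (hsafe : Prog.Safe) {Out : AdornedProgram}
    (h : IsOutput Prog Out) : Equivalent Prog Out := fun D q _ t =>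
  ⟨h.complete hsafe, by
    rintro ⟨ρ, rfl, hd⟩
    have hreach : Reachable Prog Out := h.1
    exact hreach.sound hd⟩

/-! ### Bounds on the names in a program, and homomorphisms of databases -/

/-- The name of the variable or constant is less than `m`. -/
def Term.BoundedBy (m : ℕ) : Term → Prop
  | .var x => x < m
  | .const c => c < m

/-- All names in the atom are less than `m`, and its arity is at most `m`. -/
structure Atom.BoundedBy (m : ℕ) (a : Atom ℕ) : Prop where
  pred : a.pred < m
  length : a.args.length ≤ m
  args : ∀ s ∈ a.args, s.BoundedBy m

/-- All names in the rule are less than `m`, and its lengths are at most `m`. -/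
structure Rule.BoundedBy (m : ℕ) (R : Rule ℕ) : Prop where
  head : R.head.BoundedBy m
  idb_length : R.idb.length ≤ m
  edb_length : R.edb.length ≤ m
  idb : ∀ a ∈ R.idb, a.BoundedBy m
  edb : ∀ a ∈ R.edb, a.BoundedBy m

def Program.BoundedBy (Prog : Program ℕ) (m : ℕ) : Prop := ∀ R ∈ Prog, R.BoundedBy m

theorem Atom.BoundedBy.const_lt {m : ℕ} {a : Atom ℕ} (h : a.BoundedBy m) {c : ℕ}
    (hc : Term.const c ∈ a.args) : c < m := h.args _ hc

theorem exists_const_bound (ts : List Term) : ∃ K, ∀ c, Term.const c ∈ ts → c < K := by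
  induction ts with
  | nil => exact ⟨0, by simp⟩
  | cons t ts ih =>
    obtain ⟨K, hK⟩ := ih
    cases t with
    | var x => exact ⟨K, by simpa using hK⟩
    | const d =>
      refine ⟨max K (d + 1), fun c hc => ?_⟩
      rcases List.mem_cons.1 hc with h | h
      · cases h; simp
      · exact (hK c h).trans_le (le_max_left _ _)

theorem map_ground_map {h θ : ℕ → ℕ} {ts : List Term} (hc : ∀ c, Term.const c ∈ ts → h c = c) :
    (ts.map (Term.ground θ)).map h = ts.map (Term.ground fun x => h (θ x)) := by
  rw [List.map_map]
  refine List.map_congr_left fun t ht => ?_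
  cases t with
  | var x => rfl
  | const c => exact hc c ht

/-- Proof trees are transported along maps of values that fix the constants of the program. Only
facts whose predicate and arity can occur in the program are used. The lemma serves for shifting
values, for gluing databases and for collapsing values. -/
theorem Derives.map {Prog : Program ℕ} {m : ℕ} (hB : Prog.BoundedBy m) {h : ℕ → ℕ}
    (hfix : ∀ c < m, h c = c) {D D' : Database}
    (hD : ∀ f ∈ D, f.1 < m → f.2.length ≤ m → (f.1, f.2.map h) ∈ D')
    {q : ℕ} {t : List ℕ} (hd : Derives Prog D q t) : Derives Prog D' q (t.map h) := by
  induction hd with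
  | rule R hR θ hidb hedb ih =>
    have hb := hB R hR
    rw [map_ground_map fun c hc => hfix c (hb.head.const_lt hc)]
    refine Derives.rule R hR _ (fun a ha => ?_) (fun e he => ?_)
    · rw [← map_ground_map fun c hc => hfix c ((hb.idb a ha).const_lt hc)]
      exact ih a ha
    · rw [← map_ground_map fun c hc => hfix c ((hb.edb e he).const_lt hc)]
      exact hD _ (hedb e he) (hb.edb e he).pred (by simpa using (hb.edb e he).length)

/-! ### Canonical databases -/

/-- There are databases over which an instance of the head of `ρ`, with distinct fresh values for
the variables, is derived, and in which each fact that contains some of these values is dominated by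
a body atom of `ρ`. -/
def Canonical (Prog : Program ℕ) (ρ : Adornment) : Prop :=
  ∀ F : Finset ℕ, ∃ (D : Database) (θ : ℕ → ℕ), Set.InjOn θ ρ.outVars ∧
    (∀ x ∈ ρ.outVars, θ x ∉ F) ∧ Derives Prog D ρ.pred (ρ.head.map (Term.ground θ)) ∧
    ∀ f ∈ D, ∀ x ∈ ρ.outVars, θ x ∈ f.2 → ∃ b ∈ ρ.body, ∀ j y : ℕ, y ∈ ρ.outVars →
      f.2[j]? = some (θ y) → b.args[j]? = some (some y)

theorem Canonical.variant {Prog : Program ℕ} {ρ ρ' : Adornment} (hv : ρ.Variant ρ')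
    (h : Canonical Prog ρ) : Canonical Prog ρ' := by
  obtain ⟨π, rfl⟩ := hv
  intro F
  obtain ⟨D, θ, h1, h2, h3, h4⟩ := h F
  refine ⟨D, fun x => θ (π.symm x), ?_, ?_, ?_, ?_⟩
  · intro x hx y hy hxy
    obtain ⟨x, rfl⟩ := π.surjective x
    obtain ⟨y, rfl⟩ := π.surjective y
    simp only [Equiv.symm_apply_apply] at hxy
    rw [h1 (Adornment.mem_outVars_rename.1 hx) (Adornment.mem_outVars_rename.1 hy) hxy]
  · intro x hx
    obtain ⟨x, rfl⟩ := π.surjective x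
    simpa using h2 x (Adornment.mem_outVars_rename.1 hx)
  · change Derives Prog D ρ.pred _
    rw [Adornment.head_rename_ground]
    simp only [Equiv.symm_apply_apply]
    exact h3
  · intro f hf x hx hxf
    obtain ⟨x, rfl⟩ := π.surjective x
    obtain ⟨b, hb, hj⟩ := h4 f hf x (Adornment.mem_outVars_rename.1 hx) (by simpa using hxf)
    refine ⟨_, Adornment.mem_body_rename.2 ⟨b, hb, rfl⟩, fun j y hy hjy => ?_⟩
    obtain ⟨y, rfl⟩ := π.surjective y
    exact Adornment.getElem_map_option_map.2
      (hj j y (Adornment.mem_outVars_rename.1 hy) (by simpa using hjy))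

/-- The canonical databases of the adornments are glued: in each, the value of an output variable
`y` is replaced by the value of `σ y`, and the ground EDB atoms of the rule are added. Other values
may coincide between the databases. This is harmless, as derivations survive added facts and
domination only concerns facts containing new output values. -/
theorem Inlining.canonical {Prog : Program ℕ} {m : ℕ} (hB : Prog.BoundedBy m)
    {Acc : AdornedProgram} {R : Rule ℕ} {ρs : List Adornment} {σ : ℕ → Term} {ρ : Adornment}
    {S : Rule Adornment} {Tr : Atom ℕ → Adornment → Adornment → Prop}
    (h : Inlining Prog Acc R ρs σ ρ S Tr) (hρs : ∀ ρ' ∈ ρs, Canonical Prog ρ') :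
    Canonical Prog (gOut (inlined R ρs σ)) := by
  classical
  intro F
  have hb := hB R h.mem
  have hC : ∀ ρ' ∈ ρs, ∃ (D : Database) (θ : ℕ → ℕ), Set.InjOn θ ρ'.outVars ∧
      (∀ x ∈ ρ'.outVars, m ≤ θ x ∧ Term.const (θ x) ∉ ρ'.head) ∧
      Derives Prog D ρ'.pred (ρ'.head.map (Term.ground θ)) ∧
      ∀ f ∈ D, ∀ x ∈ ρ'.outVars, θ x ∈ f.2 → ∃ b ∈ ρ'.body, ∀ j y : ℕ, y ∈ ρ'.outVars →
        f.2[j]? = some (θ y) → b.args[j]? = some (some y) := by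
    intro ρ' hρ'
    obtain ⟨K, hK⟩ := exists_const_bound ρ'.head
    -- Output values avoid the constants of the program and of the adornment's head, so that
    -- replacing them moves none of these constants.
    obtain ⟨D, θ, h1, h2, h3, h4⟩ := hρs ρ' hρ' (Finset.range (max m K))
    refine ⟨D, θ, h1, fun x hx => ?_, h3, h4⟩
    have := h2 x hx
    simp only [Finset.mem_range, lt_max_iff, not_or, not_lt] at this
    exact ⟨this.1, fun hc => (hK _ hc).not_ge this.2⟩
  choose! D θ hinj hfresh hder hdom using hC
  let W : Finset ℕ := R.vars ∪ ρs.toFinset.biUnion Adornment.outVars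
  -- Everything a new output value `x + K` must stay clear of. `K₁` does the same for the constants
  -- among the values of `σ`.
  let A : Finset ℕ := F ∪ Finset.range (m + 1) ∪
    ρs.toFinset.biUnion fun ρ' => (D ρ').biUnion fun f => f.2.toFinset
  obtain ⟨K₁, hK₁⟩ := exists_const_bound (W.toList.map σ)
  let K := max K₁ (A.sup id + 1)
  have hA : ∀ v ∈ A, v < K := fun v hv =>
    (Nat.lt_succ_of_le (Finset.le_sup (f := id) hv)).trans_le (le_max_right _ _)
  have hmK : m < K := hA m (by simp [A])
  let θ₀ : ℕ → ℕ := fun x => x + K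
  have key : ∀ y ∈ W, ∀ x, (σ y).ground θ₀ = x + K → σ y = .var x := by
    intro y hy x hx
    rcases hσ : σ y with z | c
    · rw [hσ] at hx
      simp only [Term.ground, θ₀, Nat.add_right_cancel_iff] at hx
      rw [hx]
    · have := hK₁ c (List.mem_map.2 ⟨y, by simpa using hy, hσ⟩)
      rw [hσ] at hx
      simp only [Term.ground] at hx
      have := le_max_left K₁ (A.sup id + 1)
      omega
  let g : Adornment → ℕ → ℕ := fun ρ' v =>
    if h : ∃ y ∈ ρ'.outVars, θ ρ' y = v then (σ h.choose).ground θ₀ else v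
  have hg : ∀ ρ' ∈ ρs, ∀ y ∈ ρ'.outVars, g ρ' (θ ρ' y) = (σ y).ground θ₀ := by
    intro ρ' hρ' y hy
    have hex : ∃ z ∈ ρ'.outVars, θ ρ' z = θ ρ' y := ⟨y, hy, rfl⟩
    simp only [g, dif_pos hex]
    rw [hinj ρ' hρ' hex.choose_spec.1 hy hex.choose_spec.2]
  have hg' : ∀ ρ' v, (¬ ∃ y ∈ ρ'.outVars, θ ρ' y = v) → g ρ' v = v := fun ρ' v hv => dif_neg hv
  let D₀ : Database :=
    (ρs.toFinset.biUnion fun ρ' => (D ρ').image fun f => (f.1, f.2.map (g ρ'))) ∪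
    (R.edb.map fun e => (e.pred, (e.args.map (Term.subst σ)).map (Term.ground θ₀))).toFinset
  refine ⟨D₀, θ₀, fun x _ y _ hxy => by simpa [θ₀] using hxy, fun x _ hx => ?_, ?_, ?_⟩
  · have := hA (θ₀ x) (by simp [A, hx])
    simp only [θ₀] at this
    omega
  · change Derives Prog D₀ R.head.pred ((R.head.args.map (Term.subst σ)).map (Term.ground θ₀))
    rw [map_ground_subst]
    refine Derives.rule R h.mem _ (fun a ha => ?_) (fun e he => ?_)
    · obtain ⟨ρ₁, ρ₂, htr⟩ := h.of_atom a ha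
      have hρ₂ := h.mem_adornments htr
      have h1 := Derives.map hB (h := g ρ₂) (D' := D₀) (fun c hc => hg' _ _ ?_) (fun f hf _ _ => ?_)
        (hder ρ₂ hρ₂)
      · rw [map_ground_map] at h1
        · rw [← h.pred_eq htr, ← (h.renamed htr).pred_eq, ← map_ground_subst, h.unified htr,
            map_ground_subst]
          convert h1 using 1
          exact map_ground_congr fun x hx => (hg ρ₂ hρ₂ x (Adornment.mem_outVars.2 hx)).symm
        · rintro c hc
          refine hg' _ _ ?_
          rintro ⟨y, hy, rfl⟩
          exact (hfresh ρ₂ hρ₂ y hy).2 hc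
      · rintro ⟨y, hy, rfl⟩
        exact (hfresh ρ₂ hρ₂ y hy).1.not_gt hc
      · refine Finset.mem_union_left _ (Finset.mem_biUnion.2 ⟨ρ₂, by simpa using hρ₂, ?_⟩)
        exact Finset.mem_image_of_mem (fun f : Fact => (f.1, f.2.map (g ρ₂))) hf
    · rw [← map_ground_subst]
      refine Finset.mem_union_right _ (List.mem_toFinset.2 (List.mem_map.2 ⟨e, he, rfl⟩))
  · intro f hf x hx hxf
    suffices ∃ a ∈ (inlined R ρs σ).body, ∀ j y : ℕ, f.2[j]? = some (θ₀ y) →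
        a.2[j]? = some (some (.var y)) by
      obtain ⟨a, ha, hj⟩ := this
      obtain ⟨j, hj'⟩ := List.mem_iff_getElem?.1 hxf
      obtain ⟨b, hb, hbj⟩ := exists_mem_gOut_of_raw ha (List.mem_of_getElem? (hj j x hj')) hx
      exact ⟨b, hb, fun j y hy h' => hbj j y (hj j y h') hy⟩
    rcases Finset.mem_union.1 hf with hf | hf
    · simp only [Finset.mem_biUnion, List.mem_toFinset, Finset.mem_image] at hf
      obtain ⟨ρ₂, hρ₂, f', hf', rfl⟩ := hf
      -- A value `y + K` is too large to be an unchanged old value, so it replaces the value of an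
      -- output variable that `σ` maps to `y`. This turns domination in the old database into
      -- domination by an inlined atom.
      have back : ∀ v ∈ f'.2, ∀ y, g ρ₂ v = y + K → ∃ z ∈ ρ₂.outVars, θ ρ₂ z = v ∧ σ z = .var y := by
        intro v hv y hy
        by_cases hex : ∃ z ∈ ρ₂.outVars, θ ρ₂ z = v
        · obtain ⟨z, hz, rfl⟩ := hex
          refine ⟨z, hz, rfl, key z ?_ y (hg ρ₂ hρ₂ z hz ▸ hy)⟩
          exact Finset.mem_union_right _ (Finset.mem_biUnion.2 ⟨ρ₂, by simpa using hρ₂, hz⟩)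
        · rw [hg' _ _ hex] at hy
          have := hA v (Finset.mem_union_right _ (Finset.mem_biUnion.2
            ⟨ρ₂, by simpa using hρ₂, Finset.mem_biUnion.2 ⟨f', hf', by simpa using hv⟩⟩))
          omega
      obtain ⟨v, hv, hvx⟩ := List.mem_map.1 hxf
      obtain ⟨z, hz, rfl, -⟩ := back v hv x hvx
      obtain ⟨b, hb, hbj⟩ := hdom ρ₂ hρ₂ f' hf' z hz hv
      refine ⟨_, mem_inlined_body.2 (Or.inl ⟨ρ₂, hρ₂, b, hb, rfl⟩), fun j y hj => ?_⟩
      simp only [List.getElem?_map, Option.map_eq_some_iff] at hj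
      obtain ⟨w, hw, hwy⟩ := hj
      obtain ⟨u, hu, rfl, huy⟩ := back w (List.mem_of_getElem? hw) y hwy
      simp [hbj j u hu hw, huy]
    · simp only [List.mem_toFinset, List.mem_map] at hf
      obtain ⟨e, he, rfl⟩ := hf
      refine ⟨_, mem_inlined_body.2 (Or.inr ⟨e, he, rfl⟩), fun j y hj => ?_⟩
      simp only [List.getElem?_map, Option.map_eq_some_iff] at hj
      obtain ⟨_, ⟨s, hs, rfl⟩, hsy⟩ := hj
      have hse := List.mem_of_getElem? hs
      have : s.subst σ = .var y := by
        cases s with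
        | const c =>
          have := (hb.edb e he).const_lt hse
          simp only [Term.subst, Term.ground, θ₀] at hsy
          omega
        | var z =>
          refine key z (Finset.mem_union_left _ (Finset.mem_union_right _ ?_)) y hsy
          refine mem_tupleVars.2 ?_
          simp only [List.mem_append, List.mem_flatMap]
          exact Or.inr ⟨e, he, hse⟩
      simp [hs, this]

theorem Reachable.canonical {Prog : Program ℕ} {m : ℕ} (hB : Prog.BoundedBy m)
    {Acc : AdornedProgram} (h : Reachable Prog Acc) : ∀ S ∈ Acc, Canonical Prog S.head.pred :=
  h.adornment_induction (fun _ _ hv hT => hT.variant hv)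
    fun _ _ _ _ _ _ _ hin hρs => hin.canonical hB hρs

/-! ### Covering derived tuples by facts -/

/-- The facts in `C` contain all values of the tuple `t` that are at least `m`. -/
def CoversFrom (m : ℕ) (C : Finset Fact) (t : List ℕ) : Prop :=
  ∀ v ∈ t, m ≤ v → ∃ f ∈ C, v ∈ f.2

theorem AdornedProgram.ew_le_of_mem {Prog : AdornedProgram} {S : Rule Adornment} (hS : S ∈ Prog) :
    S.head.pred.ew ≤ Prog.ew S.head.pred.pred := by
  have key : ∀ l : List ℕ, ∀ a ∈ l, a ≤ l.foldr max 0 := by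
    intro l
    induction l with
    | nil => simp
    | cons b l ih => simpa using fun a ha => Or.inr (ih a ha)
  exact key _ _ (List.mem_map.2 ⟨S, List.mem_filter.2 ⟨hS, by simp⟩, rfl⟩)

/-- Value 0 is excluded because the maximum over no rules is also 0. -/
theorem AdornedProgram.exists_ew_eq {Prog : AdornedProgram} {q : ℕ} (h : Prog.ew q ≠ 0) :
    ∃ S ∈ Prog, S.head.pred.pred = q ∧ S.head.pred.ew = Prog.ew q := by
  have key : ∀ l : List ℕ, l.foldr max 0 ≠ 0 → l.foldr max 0 ∈ l := by
    intro l
    induction l with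
    | nil => simp
    | cons b l ih =>
      intro hne
      simp only [List.foldr_cons] at hne ⊢
      rcases max_cases b (l.foldr max 0) with ⟨h1, -⟩ | ⟨h1, -⟩
      · rw [h1]; simp
      · rw [h1] at hne ⊢
        exact List.mem_cons_of_mem _ (ih hne)
  obtain ⟨S, hS, hS'⟩ := List.mem_map.1 (key _ h)
  obtain ⟨h1, h2⟩ := List.mem_filter.1 hS
  exact ⟨S, h1, by simpa using h2, hS'⟩

theorem Adornment.Safe.exists_edgeCover {ρ : Adornment} (h : ρ.Safe) :
    ∃ C, ρ.IsEdgeCover C ∧ C.card = ρ.ew := by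
  refine Nat.sInf_mem (s := {k | ∃ C, ρ.IsEdgeCover C ∧ C.card = k})
    ⟨_, ρ.edges, ⟨subset_rfl, fun x hx => ?_⟩, rfl⟩
  obtain ⟨b, hb, hxb⟩ := Adornment.mem_bodyVars.1 (h hx)
  exact ⟨_, Finset.mem_image_of_mem _ hb, Adornment.inl_mem_edge.2 hxb⟩

/-- Derived tuples are covered by as many facts as the width of an equivalent EDB-bounded program
allows. -/
theorem exists_cover_of_derives {Prog : Program ℕ} {m : ℕ} (hB : Prog.BoundedBy m)
    {Other : AdornedProgram} (hO : AdornedProgram.EDBBounded Other) (hE : Equivalent Prog Other)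
    {q : ℕ} (hq : Prog.IsIDB q) {D : Database} {t : List ℕ} (hd : Derives Prog D q t) :
    ∃ C ⊆ D, C.card ≤ AdornedProgram.ew Other q ∧ CoversFrom m C t := by
  classical
  obtain ⟨K, hK⟩ := exists_const_bound (Other.flatMap fun S => S.head.pred.head)
  -- The program has no constants from `m` on, so it cannot notice the shift. In the shifted tuple,
  -- an image `v + K` exceeds every constant in a head of `Other`, hence comes from a head variable.
  let h : ℕ → ℕ := fun v => if v < m then v else v + K
  have hd' := Derives.map hB (h := h) (D' := D.image fun f => (f.1, f.2.map h))
    (fun c hc => if_pos hc)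
    (fun f hf _ _ => Finset.mem_image_of_mem (fun f : Fact => (f.1, f.2.map h)) hf) hd
  obtain ⟨ρ, rfl, hρ⟩ := (hE _ q hq _).1 hd'
  obtain ⟨S, hS, rfl, hby⟩ := hρ.exists_rule
  have hprod := hO.2 S hS _ _ hby
  have hsafe := (hO.1 S hS).1.1
  obtain ⟨θ, ht, hθ⟩ := Adornment.produces_iff.1 hprod
  obtain ⟨C, hC, hcard⟩ := hsafe.exists_edgeCover
  have hf : ∀ e ∈ C, ∃ f ∈ D, ∀ x : ℕ, (Sum.inl x : Adornment.Vertex) ∈ e → θ x ∈ f.2.map h := by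
    intro e he
    obtain ⟨b, hb, rfl⟩ := Finset.mem_image.1 (hC.1 he)
    obtain ⟨d, hd, -, hj⟩ := hθ b hb
    obtain ⟨f, hf, hfd⟩ := Finset.mem_image.1 hd
    refine ⟨f, hf, fun x hx => ?_⟩
    obtain ⟨j, hjx⟩ := BodyAtom.mem_vars_iff_getElem.1 (Adornment.inl_mem_edge.1 hx)
    rw [(Prod.mk.inj hfd).2]
    exact List.mem_of_getElem? (hj j x hjx)
  choose! F hFD hF using hf
  refine ⟨C.image F, ?_, ?_, ?_⟩
  · intro f hf
    obtain ⟨e, he, rfl⟩ := Finset.mem_image.1 hf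
    exact hFD e he
  · exact Finset.card_image_le.trans (hcard.le.trans (AdornedProgram.ew_le_of_mem hS))
  · intro v hv hmv
    have hhv : h v = v + K := if_neg hmv.not_gt
    have hmem : v + K ∈ S.head.pred.head.map (Term.ground θ) := by
      rw [← ht, ← hhv]
      exact List.mem_map_of_mem hv
    obtain ⟨s, hs, hsv⟩ := List.mem_map.1 hmem
    cases s with
    | const c =>
      have := hK c (List.mem_flatMap.2 ⟨S, hS, hs⟩)
      simp only [Term.ground] at hsv
      omega
    | var y =>
      obtain ⟨e, he, hye⟩ := hC.2 y (Adornment.mem_outVars.2 hs)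
      refine ⟨F e, Finset.mem_image_of_mem _ he, ?_⟩
      obtain ⟨u, hu, huv⟩ := List.mem_map.1 (hF e he y hye)
      simp only [Term.ground] at hsv
      rw [hsv] at huv
      have : u = v := by
        simp only [h] at huv
        split_ifs at huv <;> omega
      exact this ▸ hu

/-- The width `w` is needed: some derived tuple has no cover by fewer than `w` facts. -/
def NeedsWidth (Prog : Program ℕ) (m q w : ℕ) : Prop :=
  ∃ (D : Database) (t : List ℕ), Derives Prog D q t ∧ ∀ C ⊆ D, CoversFrom m C t → w ≤ C.card

theorem NeedsWidth.le_ew {Prog : Program ℕ} {m : ℕ} (hB : Prog.BoundedBy m)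
    {Other : AdornedProgram} (hO : AdornedProgram.EDBBounded Other) (hE : Equivalent Prog Other)
    {q w : ℕ} (hq : Prog.IsIDB q) (h : NeedsWidth Prog m q w) : w ≤ AdornedProgram.ew Other q := by
  obtain ⟨D, t, hd, hC⟩ := h
  obtain ⟨C, hCD, hcard, hcov⟩ := exists_cover_of_derives hB hO hE hq hd
  exact (hC C hCD hcov).trans hcard

/-- Replacing each fact of a cover by the hyperedge of a dominating body atom produces an edge cover
of the adornment. The fresh values are taken from `m` on, so that a cover has to contain all of
them. -/
theorem Canonical.needsWidth {Prog : Program ℕ} {ρ : Adornment} (h : Canonical Prog ρ) (m : ℕ) :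
    NeedsWidth Prog m ρ.pred ρ.ew := by
  classical
  obtain ⟨D, θ, hinj, hfresh, hder, hdom⟩ := h (Finset.range m)
  refine ⟨D, _, hder, fun C hCD hC => ?_⟩
  have : Nonempty BodyAtom := ⟨⟨0, []⟩⟩
  choose! B hB hdomB using fun (f : Fact) (hf : f ∈ C ∧ ∃ x ∈ ρ.outVars, θ x ∈ f.2) =>
    hdom f (hCD hf.1) hf.2.choose hf.2.choose_spec.1 hf.2.choose_spec.2
  -- Facts without output values need not have a dominating atom, and they cover no output variable.
  let C' := C.filter fun f => ∃ x ∈ ρ.outVars, θ x ∈ f.2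
  have hcov : ρ.IsEdgeCover (C'.image fun f => Adornment.edge (B f)) := by
    refine ⟨fun e he => ?_, fun x hx => ?_⟩
    · obtain ⟨f, hf, rfl⟩ := Finset.mem_image.1 he
      exact Finset.mem_image_of_mem _ (hB f (Finset.mem_filter.1 hf))
    · obtain ⟨f, hf, hxf⟩ := hC (θ x) (List.mem_map.2 ⟨_, Adornment.mem_outVars.1 hx, rfl⟩)
        (by simpa using hfresh x hx)
      have hf' : f ∈ C' := Finset.mem_filter.2 ⟨hf, x, hx, hxf⟩
      refine ⟨_, Finset.mem_image_of_mem _ hf', Adornment.inl_mem_edge.2 ?_⟩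
      obtain ⟨j, hj⟩ := List.mem_iff_getElem?.1 hxf
      exact BodyAtom.mem_vars_iff_getElem.2
        ⟨j, hdomB f (Finset.mem_filter.1 hf') j x hx hj⟩
  calc ρ.ew ≤ _ := Nat.sInf_le ⟨_, hcov, rfl⟩
    _ ≤ C'.card := Finset.card_image_le
    _ ≤ C.card := Finset.card_filter_le _ _

theorem Reachable.needsWidth {Prog : Program ℕ} {m : ℕ} (hB : Prog.BoundedBy m)
    {Out : AdornedProgram} (h : Reachable Prog Out) {q : ℕ}
    (hq : AdornedProgram.ew Out q ≠ 0) : NeedsWidth Prog m q (AdornedProgram.ew Out q) := by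
  obtain ⟨S, hS, rfl, hw⟩ := AdornedProgram.exists_ew_eq hq
  exact hw ▸ (h.canonical hB S hS).needsWidth m

/-! ### Termination of the construction -/

theorem finite_lists {α : Type*} {s : Set α} (hs : s.Finite) (n : ℕ) :
    {l : List α | l.length ≤ n ∧ ∀ a ∈ l, a ∈ s}.Finite := by
  induction n with
  | zero =>
    refine (Set.finite_singleton []).subset fun l hl => ?_
    simpa using hl.1
  | succ n ih =>
    refine ((Set.finite_singleton []).union
      ((hs.prod ih).image fun p : α × List α => p.1 :: p.2)).subset fun l hl => ?_
    cases l with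
    | nil => simp
    | cons a l =>
      obtain ⟨h1, h2⟩ := hl
      refine Or.inr ⟨(a, l), ⟨h2 a (by simp), ?_, fun b hb => h2 b (by simp [hb])⟩, rfl⟩
      simpa using h1

theorem finite_terms (m : ℕ) : {t : Term | t.BoundedBy m}.Finite := by
  refine (((Set.finite_Iio m).image Term.var).union ((Set.finite_Iio m).image Term.const)).subset ?_
  rintro (x | c) h
  · exact Or.inl ⟨x, h, rfl⟩
  · exact Or.inr ⟨c, h, rfl⟩

theorem finite_atoms {P : Type} {s : Set P} (hs : s.Finite) (m : ℕ) :
    {a : Atom P | a.pred ∈ s ∧ a.args.length ≤ m ∧ ∀ t ∈ a.args, t.BoundedBy m}.Finite := by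
  refine ((hs.prod (finite_lists (finite_terms m) m)).image
    fun p : P × List Term => (⟨p.1, p.2⟩ : Atom P)).subset ?_
  rintro ⟨p, l⟩ ⟨h1, h2, h3⟩
  exact ⟨(p, l), ⟨h1, h2, h3⟩, rfl⟩

theorem finite_rules {I : Type} {s : Set I} (hs : s.Finite) (m : ℕ) :
    {R : Rule I | (R.head.pred ∈ s ∧ R.head.args.length ≤ m ∧ ∀ t ∈ R.head.args, t.BoundedBy m) ∧
      (R.idb.length ≤ m ∧ ∀ a ∈ R.idb,
        a.pred ∈ s ∧ a.args.length ≤ m ∧ ∀ t ∈ a.args, t.BoundedBy m) ∧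
      (R.edb.length ≤ m ∧ ∀ a ∈ R.edb,
        a.pred ∈ Set.Iio m ∧ a.args.length ≤ m ∧ ∀ t ∈ a.args, t.BoundedBy m)}.Finite := by
  refine (((finite_atoms hs m).prod ((finite_lists (finite_atoms hs m) m).prod
    (finite_lists (finite_atoms (Set.finite_Iio m) m) m))).image
    fun p : Atom I × List (Atom I) × List (Atom ℕ) => (⟨p.1, p.2.1, p.2.2⟩ : Rule I)).subset ?_
  rintro ⟨a, l, l'⟩ ⟨h1, h2, h3⟩
  exact ⟨(a, l, l'), ⟨h1, h2, h3⟩, rfl⟩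

namespace Adornment

/-- All names and lengths in the adornment, except for the names of variables, are bounded. -/
structure Shape (m : ℕ) (ρ : Adornment) : Prop where
  pred : ρ.pred < m
  length : ρ.head.length ≤ m
  const : ∀ c, Term.const c ∈ ρ.head → c < m
  body : ∀ b ∈ ρ.body, b.pred < m ∧ b.args.length ≤ m
  vars : ρ.bodyVars ⊆ ρ.outVars

/-- All names and lengths in the adornment are bounded. -/
structure Small (m : ℕ) (ρ : Adornment) : Prop where
  pred : ρ.pred < m
  length : ρ.head.length ≤ m
  head : ∀ s ∈ ρ.head, s.BoundedBy m
  body : ∀ b ∈ ρ.body, b.pred < m ∧ b.args.length ≤ m ∧ ∀ x, some x ∈ b.args → x < m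

theorem finite_small (m : ℕ) : {ρ : Adornment | ρ.Small m}.Finite := by
  have h1 : {o : Option ℕ | ∀ x, o = some x → x < m}.Finite := by
    refine ((Set.finite_singleton none).union ((Set.finite_Iio m).image some)).subset ?_
    rintro (_ | x) h
    · exact Or.inl rfl
    · exact Or.inr ⟨x, h x rfl, rfl⟩
  have h2 : {b : BodyAtom | b.pred < m ∧ b.args.length ≤ m ∧
      ∀ o ∈ b.args, ∀ x, o = some x → x < m}.Finite := by
    refine (((Set.finite_Iio m).prod (finite_lists h1 m)).image
      fun p : ℕ × List (Option ℕ) => (⟨p.1, p.2⟩ : BodyAtom)).subset ?_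
    rintro ⟨p, l⟩ ⟨h1, h2, h3⟩
    exact ⟨(p, l), ⟨h1, h2, h3⟩, rfl⟩
  refine (((Set.finite_Iio m).prod ((finite_lists (finite_terms m) m).prod
    h2.toFinset.powerset.finite_toSet)).image
    fun p : ℕ × List Term × Finset BodyAtom => (⟨p.1, p.2.1, p.2.2⟩ : Adornment)).subset ?_
  rintro ⟨p, l, B⟩ h
  refine ⟨(p, l, B), ⟨h.pred, ⟨h.length, h.head⟩, ?_⟩, rfl⟩
  simp only [Finset.coe_powerset, Set.mem_preimage, Set.mem_powerset_iff]
  intro b hb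
  obtain ⟨h3, h4, h5⟩ := h.body b hb
  simp only [Set.Finite.coe_toFinset, Set.mem_ofPred_eq]
  exact ⟨h3, h4, fun o ho x hx => h5 x (hx ▸ ho)⟩

theorem const_mem_head_rename {ρ : Adornment} {π : Equiv.Perm ℕ} {c : ℕ} :
    Term.const c ∈ (ρ.rename π).head ↔ Term.const c ∈ ρ.head := by
  simp only [rename, List.mem_map]
  constructor
  · rintro ⟨t, ht, h⟩
    cases t with
    | var y => simp [Term.subst] at h
    | const d => simp only [Term.subst, Term.const.injEq] at h; exact h ▸ ht
  · exact fun h => ⟨_, h, rfl⟩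

theorem Shape.variant {m : ℕ} {ρ ρ' : Adornment} (hv : ρ.Variant ρ') (h : ρ.Shape m) :
    ρ'.Shape m := by
  have hvars := hv.bodyVars_subset h.vars
  obtain ⟨π, rfl⟩ := hv
  refine ⟨h.pred, by simpa [rename] using h.length,
    fun c hc => h.const c (const_mem_head_rename.1 hc), fun b hb => ?_, hvars⟩
  obtain ⟨b, hb', rfl⟩ := mem_body_rename.1 hb
  simpa using h.body b hb'

theorem card_outVars_le (ρ : Adornment) : ρ.outVars.card ≤ ρ.head.length := by
  have : ∀ ts : List Term, (tupleVars ts).card ≤ ts.length := by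
    intro ts
    induction ts with
    | nil => simp [tupleVars]
    | cons t ts ih =>
      refine (Finset.card_union_le _ _).trans ?_
      have : t.vars.card ≤ 1 := by cases t <;> simp [Term.vars]
      simp only [List.length_cons]
      omega
  exact this _

theorem Shape.exists_small {m : ℕ} {ρ : Adornment} (h : ρ.Shape m) :
    ∃ ρ', ρ.Variant ρ' ∧ ρ'.Small m := by
  obtain ⟨π, hπ⟩ := exists_perm_lt ρ.outVars (ρ.card_outVars_le.trans h.length)
  have h' := h.variant ⟨π, rfl⟩
  have hout : ∀ x ∈ (ρ.rename π).outVars, x < m := by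
    intro x hx
    obtain ⟨y, rfl⟩ := π.surjective x
    exact hπ y (mem_outVars_rename.1 hx)
  refine ⟨ρ.rename π, ⟨π, rfl⟩, h'.pred, h'.length, ?_, fun b hb => ⟨(h'.body b hb).1,
    (h'.body b hb).2, fun x hx => hout x (h'.vars (mem_bodyVars.2 ⟨b, hb, BodyAtom.mem_vars.2 hx⟩))⟩⟩
  rintro (x | c) hs
  · exact hout x (mem_outVars.2 hs)
  · exact h'.const c hs

end Adornment

theorem Inlining.const_lt {Prog : Program ℕ} {m : ℕ} (hB : Prog.BoundedBy m)
    {Acc : AdornedProgram} {R : Rule ℕ} {ρs : List Adornment} {σ : ℕ → Term} {ρ : Adornment}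
    {S : Rule Adornment} {Tr : Atom ℕ → Adornment → Adornment → Prop}
    (h : Inlining Prog Acc R ρs σ ρ S Tr) (hρs : ∀ ρ' ∈ ρs, ρ'.Shape m) {x c : ℕ}
    (hx : σ x = .const c) : c < m := by
  obtain ⟨E, hE, hE'⟩ := h.mgu
  obtain ⟨p, hp, hc⟩ := hE.const_mem hx
  obtain ⟨a, ha, ρ', hρ', rfl⟩ := hE' p hp
  rcases hc with hc | hc
  · exact ((hB R h.mem).idb a ha).const_lt hc
  · exact (hρs ρ' hρ').const c hc

/-- The lengths and predicates of body atoms are inherited from EDB atoms of the program, and the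
unifier adds no constants. Only names of variables could grow, which renaming repairs. -/
theorem Inlining.gOut_shape {Prog : Program ℕ} {m : ℕ} (hB : Prog.BoundedBy m)
    {Acc : AdornedProgram} {R : Rule ℕ} {ρs : List Adornment} {σ : ℕ → Term} {ρ : Adornment}
    {S : Rule Adornment} {Tr : Atom ℕ → Adornment → Adornment → Prop}
    (h : Inlining Prog Acc R ρs σ ρ S Tr) (hρs : ∀ ρ' ∈ ρs, ρ'.Shape m) :
    (gOut (inlined R ρs σ)).Shape m := by
  have hb := hB R h.mem
  refine ⟨hb.head.pred, by simpa [gOut, inlined] using hb.head.length, fun c hc => ?_,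
    fun b hbm => ?_, gOut_bodyVars_subset _⟩
  · obtain ⟨s, hs, hsc⟩ := List.mem_map.1 (show Term.const c ∈ R.head.args.map (Term.subst σ) from hc)
    cases s with
    | var x => exact h.const_lt hB hρs hsc
    | const d =>
      simp only [Term.subst, Term.const.injEq] at hsc
      exact hsc ▸ hb.head.const_lt hs
  · obtain ⟨a, ha, rfl⟩ := exists_raw_of_mem_gOut hbm
    rcases mem_inlined_body.1 ha with ⟨ρ₂, hρ₂, b, hb', rfl⟩ | ⟨e, he, rfl⟩
    · simpa using (hρs ρ₂ hρ₂).body b hb'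
    · simpa using ⟨(hb.edb e he).pred, (hb.edb e he).length⟩

theorem Reachable.shape {Prog : Program ℕ} {m : ℕ} (hB : Prog.BoundedBy m)
    {Acc : AdornedProgram} (h : Reachable Prog Acc) : ∀ S ∈ Acc, S.head.pred.Shape m :=
  h.adornment_induction (fun _ _ hv hT => hT.variant hv)
    fun _ _ _ _ _ _ _ hin hρs => hin.gOut_shape hB hρs

theorem Rule.BoundedBy.lt_of_mem_vars {m : ℕ} {R : Rule ℕ} (h : R.BoundedBy m) {x : ℕ}
    (hx : x ∈ R.vars) : x < m := by
  rcases Finset.mem_union.1 hx with hx | hx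
  · exact h.head.args _ (mem_tupleVars.1 hx)
  · have := mem_tupleVars.1 hx
    simp only [List.mem_append, List.mem_flatMap] at this
    rcases this with ⟨a, ha, hxa⟩ | ⟨a, ha, hxa⟩
    · exact (h.idb a ha).args _ hxa
    · exact (h.edb a ha).args _ hxa

/-- The rule, with the variables renamed by `π` and the predicates by `c`. -/
def Rule.relabel (c : Adornment → Adornment) (π : Equiv.Perm ℕ) (S : Rule Adornment) :
    Rule Adornment :=
  ⟨⟨c S.head.pred, S.head.args.map (Term.subst fun x => .var (π x))⟩,
    S.idb.map fun a => ⟨c a.pred, a.args.map (Term.subst fun x => .var (π x))⟩,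
    S.edb.map (Atom.subst fun x => .var (π x))⟩

/-- A generated rule contains only variables occurring in `σ y` with `y` in the rule of the program,
hence at most `m` of them. After renaming these and normalising its predicates by `c`, the rule
falls into the finite set of `finite_rules`. -/
theorem Reachable.exists_relabel {Prog : Program ℕ} {m : ℕ} (hB : Prog.BoundedBy m)
    {Acc : AdornedProgram} (h : Reachable Prog Acc) {c : Adornment → Adornment}
    (hc : ∀ ρ : Adornment, ρ.Shape m → (c ρ).Small m) {S : Rule Adornment} (hS : S ∈ Acc) :
    ∃ π, S.relabel c π ∈ {R : Rule Adornment |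
      (R.head.pred ∈ {ρ : Adornment | ρ.Small m} ∧ R.head.args.length ≤ m ∧
        ∀ t ∈ R.head.args, t.BoundedBy m) ∧
      (R.idb.length ≤ m ∧ ∀ a ∈ R.idb,
        a.pred ∈ {ρ : Adornment | ρ.Small m} ∧ a.args.length ≤ m ∧ ∀ t ∈ a.args, t.BoundedBy m) ∧
      (R.edb.length ≤ m ∧ ∀ a ∈ R.edb,
        a.pred ∈ Set.Iio m ∧ a.args.length ≤ m ∧ ∀ t ∈ a.args, t.BoundedBy m)} := by
  classical
  obtain ⟨Acc', hAcc', hsub, hcand⟩ := h.exists_candidate hS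
  obtain ⟨R, ρs, σ, ρ, Tr, hin⟩ := hcand.exists_inlining
  have hb := hB R hin.mem
  have hρs : ∀ ρ' ∈ ρs, ρ'.Shape m := by
    intro ρ₂ hρ₂
    obtain ⟨a, ρ₁, htr⟩ := hin.of_adornment ρ₂ hρ₂
    obtain ⟨S', hS', rfl⟩ := hin.heads htr
    exact (hAcc'.shape hB S' hS').variant (hin.renamed htr)
  -- The value 0 is a filler for those `y` that `σ` sends to a constant.
  let V : Finset ℕ := R.vars.image fun y => match σ y with | .var x => x | .const _ => 0
  have hV : V.card ≤ m := by
    refine Finset.card_image_le.trans ?_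
    have : R.vars ⊆ Finset.range m := fun x hx => Finset.mem_range.2 (hb.lt_of_mem_vars hx)
    simpa using Finset.card_le_card this
  obtain ⟨π, hπ⟩ := exists_perm_lt V hV
  have key : ∀ ts : List Term, (∀ x, Term.var x ∈ ts → x ∈ R.vars) →
      (∀ c, Term.const c ∈ ts → c < m) →
      ∀ t ∈ (ts.map (Term.subst σ)).map (Term.subst fun x => .var (π x)), t.BoundedBy m := by
    intro ts h1 h2 t ht
    obtain ⟨_, ht', rfl⟩ := List.mem_map.1 ht
    obtain ⟨s, hs, rfl⟩ := List.mem_map.1 ht'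
    cases s with
    | const d => exact h2 d hs
    | var y =>
      rcases hy : σ y with x | d
      · simp only [Term.subst, hy]
        refine hπ x (Finset.mem_image.2 ⟨y, h1 y hs, ?_⟩)
        simp [hy]
      · simp only [Term.subst, hy]
        exact hin.const_lt hB hρs hy
  refine ⟨π, ⟨?_, ?_, ?_⟩, ⟨?_, ?_⟩, ?_, ?_⟩
  · exact hc _ (h.shape hB S hS)
  · simpa [Rule.relabel, hin.head] using hb.head.length
  · simp only [Rule.relabel, hin.head]
    exact key _ (fun x hx => Finset.mem_union_left _ (mem_tupleVars.2 hx))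
      fun c hc => hb.head.const_lt hc
  · simpa [Rule.relabel] using hin.idb_length.trans hb.idb_length
  · intro a ha
    obtain ⟨z, hz, rfl⟩ := List.mem_map.1 ha
    obtain ⟨S', hS', hS''⟩ := h.idb_heads hS hz
    refine ⟨hc _ (hS'' ▸ h.shape hB S' hS'), ?_⟩
    obtain ⟨a, ρ₁, ρ₂, htr, rfl⟩ := hin.of_idb z hz
    have ha := hin.mem_idb htr
    refine ⟨by simpa using (hb.idb a ha).length, key _ (fun x hx => ?_)
      fun c hc => (hb.idb a ha).const_lt hc⟩
    refine Finset.mem_union_right _ (mem_tupleVars.2 ?_)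
    simp only [List.mem_append, List.mem_flatMap]
    exact Or.inl ⟨a, ha, hx⟩
  · simpa [Rule.relabel, hin.edb] using hb.edb_length
  · intro a ha
    simp only [Rule.relabel, hin.edb, List.map_map] at ha
    obtain ⟨e, he, rfl⟩ := List.mem_map.1 ha
    refine ⟨(hb.edb e he).pred, by simpa [Atom.subst] using (hb.edb e he).length,
      key _ (fun x hx => ?_) fun c hc => (hb.edb e he).const_lt hc⟩
    refine Finset.mem_union_right _ (mem_tupleVars.2 ?_)
    simp only [List.mem_append, List.mem_flatMap]
    exact Or.inr ⟨e, he, hx⟩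

theorem map_eq_map_of_map_eq {α β γ δ : Type*} {f : α → γ} {g : β → γ} {f' : α → δ} {g' : β → δ}
    {l : List α} {l' : List β} (h : l.map f = l'.map g)
    (H : ∀ a ∈ l, ∀ b ∈ l', f a = g b → f' a = g' b) : l.map f' = l'.map g' := by
  induction l generalizing l' with
  | nil => cases l' <;> simp_all
  | cons a l ih =>
    cases l' with
    | nil => simp at h
    | cons b l' =>
      simp only [List.map_cons, List.cons.injEq] at h ⊢
      exact ⟨H a (by simp) b (by simp) h.1,
        ih h.2 fun a ha b hb => H a (by simp [ha]) b (by simp [hb])⟩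

theorem map_subst_var_perm_inj {π π' : Equiv.Perm ℕ} {l l' : List Term}
    (h : l.map (Term.subst fun x => .var (π x)) = l'.map (Term.subst fun x => .var (π' x))) :
    l' = l.map (Term.subst fun x => .var ((π'⁻¹ * π) x)) := by
  have := congrArg (List.map (Term.subst fun x => .var (π'⁻¹ x))) h
  have hinv : ∀ x, π'⁻¹ (π' x) = x := π'.symm_apply_apply
  simp only [map_subst_subst, Term.subst, hinv] at this
  have h2 : l'.map (Term.subst fun x => .var x) = l' :=
    (List.map_congr_left fun t _ => Term.subst_var t).trans (List.map_id _)
  rw [h2] at this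
  exact this.symm

theorem Rule.variant_of_relabel_eq {c : Adornment → Adornment} {π π' : Equiv.Perm ℕ}
    {S S' : Rule Adornment} (h : S.relabel c π = S'.relabel c π')
    (hhead : c S.head.pred = c S'.head.pred → S.head.pred = S'.head.pred)
    (hidb : ∀ a ∈ S.idb, ∀ a' ∈ S'.idb, c a.pred = c a'.pred → a.pred = a'.pred) :
    S.Variant S' := by
  obtain ⟨⟨p, l⟩, L, E⟩ := S
  obtain ⟨⟨p', l'⟩, L', E'⟩ := S'
  simp only [Rule.relabel, Rule.mk.injEq, Atom.mk.injEq] at h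
  obtain ⟨⟨h1, h2⟩, h3, h4⟩ := h
  refine ⟨π'⁻¹ * π, ?_⟩
  simp only [Rule.subst, Atom.subst, Rule.mk.injEq, Atom.mk.injEq]
  refine ⟨⟨(hhead h1).symm, map_subst_var_perm_inj h2⟩, ?_, ?_⟩
  · have := map_eq_map_of_map_eq h3 (f' := Atom.subst fun x => .var ((π'⁻¹ * π) x)) (g' := id)
      fun a ha b hb hab => by
        simp only [Atom.mk.injEq] at hab
        obtain ⟨q, s⟩ := b
        simp only [Atom.subst, id, Atom.mk.injEq]
        exact ⟨hidb a ha _ hb hab.1, (map_subst_var_perm_inj hab.2).symm⟩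
    rw [List.map_id] at this
    exact this.symm
  · have := map_eq_map_of_map_eq h4 (f' := Atom.subst fun x => .var ((π'⁻¹ * π) x)) (g' := id)
      fun a ha b hb hab => by
        simp only [Atom.subst, Atom.mk.injEq] at hab
        obtain ⟨q, s⟩ := b
        simp only [Atom.subst, id, Atom.mk.injEq]
        exact ⟨hab.1, (map_subst_var_perm_inj hab.2).symm⟩
    rw [List.map_id] at this
    exact this.symm

theorem Reachable.pairwise_not_variant {Prog : Program ℕ} {Acc : AdornedProgram}
    (h : Reachable Prog Acc) : Acc.Pairwise fun S S' => ¬ S.Variant S' := by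
  induction h with
  | refl => exact .nil
  | tail h1 h2 ih =>
    obtain ⟨R', -, hne, rfl⟩ := h2
    exact .cons (fun S hS hv => hne ⟨S, hS, hv⟩) ih

/-- Pigeonhole: relabelling sends the rules into a fixed finite set and is injective on a reachable
program. Indeed `c ρ` is a variant of `ρ`, so `c` separates the adornments in use, and rules with
equal relabellings are variants, which `hEq` excludes. -/
theorem exists_length_bound {Prog : Program ℕ} {m : ℕ} (hB : Prog.BoundedBy m) :
    ∃ N, ∀ Acc, Reachable Prog Acc → Acc.length ≤ N := by
  classical
  choose! c hc using fun (ρ : Adornment) (h : ρ.Shape m) => h.exists_small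
  have hfin := finite_rules (Adornment.finite_small m) m
  refine ⟨hfin.toFinset.card, fun Acc h => ?_⟩
  choose! π hπ using fun S (hS : S ∈ Acc) =>
    h.exists_relabel hB (c := c) (fun ρ hρ => (hc ρ hρ).2) hS
  have hinj : ∀ S ∈ Acc, ∀ S' ∈ Acc, c S.head.pred = c S'.head.pred →
      S.head.pred = S'.head.pred := fun S hS S' hS' heq =>
    h.variant_unique S hS S' hS' ((hc _ (h.shape hB S hS)).1.trans
      (heq ▸ (hc _ (h.shape hB S' hS')).1.symm))
  have hnd : (Acc.map fun S => S.relabel c (π S)).Nodup := by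
    rw [List.Nodup, List.pairwise_map]
    refine h.pairwise_not_variant.imp_of_mem fun {S S'} hS hS' hv heq => hv ?_
    refine Rule.variant_of_relabel_eq heq (hinj S hS S' hS') fun a ha a' ha' haa => ?_
    obtain ⟨T, hT, hT'⟩ := h.idb_heads hS ha
    obtain ⟨U, hU, hU'⟩ := h.idb_heads hS' ha'
    rw [← hT', ← hU'] at haa ⊢
    exact hinj T hT U hU haa
  rw [← List.length_map (as := Acc) (fun S => S.relabel c (π S)), ← List.toFinset_card_of_nodup hnd]
  refine Finset.card_le_card fun u hu => ?_
  obtain ⟨S, hS, rfl⟩ := List.mem_map.1 (List.mem_toFinset.1 hu)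
  exact hfin.mem_toFinset.2 (hπ S hS)

/-- Without an output, every reachable program could be extended, against the bound on lengths. -/
theorem exists_isOutput {Prog : Program ℕ} {m : ℕ} (hB : Prog.BoundedBy m) :
    ∃ Out, IsOutput Prog Out := by
  by_contra! hno
  have hlong : ∀ n : ℕ, ∃ Acc, Reachable Prog Acc ∧ Acc.length = n := by
    intro n
    induction n with
    | zero => exact ⟨[], .refl, rfl⟩
    | succ n ih =>
      obtain ⟨Acc, h1, h2⟩ := ih
      have := hno Acc
      simp only [IsOutput, not_and, not_forall] at this
      obtain ⟨R', hR', hne⟩ := this h1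
      exact ⟨R' :: Acc, h1.tail ⟨R', hR', hne, rfl⟩, by simp [h2]⟩
  obtain ⟨N, hN⟩ := exists_length_bound hB
  obtain ⟨Acc, h1, h2⟩ := hlong (N + 1)
  have := hN Acc h1
  omega

/-! ### A finite search for the width -/

theorem encode_lt_of_mem {α : Type*} [Encodable α] {a : α} {l : List α} (h : a ∈ l) :
    Encodable.encode a < Encodable.encode l := by
  induction l with
  | nil => simp at h
  | cons b l ih =>
    rw [Encodable.encode_list_cons, Nat.lt_succ_iff]
    rcases List.mem_cons.1 h with rfl | h
    · exact Nat.left_le_pair _ _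
    · exact (ih h).le.trans (Nat.right_le_pair _ _)

theorem length_le_encode {α : Type*} [Encodable α] (l : List α) :
    l.length ≤ Encodable.encode l := by
  induction l with
  | nil => simp
  | cons b l ih =>
    rw [Encodable.encode_list_cons, List.length_cons]
    exact Nat.succ_le_succ (ih.trans (Nat.right_le_pair _ _))

theorem Term.boundedBy_of_encode_lt {m : ℕ} {t : Term} (h : Encodable.encode t < m) :
    t.BoundedBy m := by
  cases t with
  | var x =>
    have : Encodable.encode (Term.var x) = 2 * x := rfl
    simp only [Term.BoundedBy]
    omega
  | const c =>
    have : Encodable.encode (Term.const c) = 2 * c + 1 := rfl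
    simp only [Term.BoundedBy]
    omega

theorem Atom.boundedBy_of_encode_lt {m : ℕ} {a : Atom ℕ} (h : Encodable.encode a < m) :
    a.BoundedBy m := by
  have he : Encodable.encode a = Nat.pair a.pred (Encodable.encode a.args) := rfl
  have h1 := Nat.left_le_pair a.pred (Encodable.encode a.args)
  have h2 := Nat.right_le_pair a.pred (Encodable.encode a.args)
  refine ⟨by omega, (length_le_encode _).trans (by omega), fun s hs => ?_⟩
  have := encode_lt_of_mem hs
  exact Term.boundedBy_of_encode_lt (by omega)

theorem Rule.boundedBy_of_encode_lt {m : ℕ} {R : Rule ℕ} (h : Encodable.encode R < m) :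
    R.BoundedBy m := by
  have he : Encodable.encode R = Nat.pair (Encodable.encode R.head)
    (Nat.pair (Encodable.encode R.idb) (Encodable.encode R.edb)) := rfl
  have h1 := Nat.left_le_pair (Encodable.encode R.head)
    (Nat.pair (Encodable.encode R.idb) (Encodable.encode R.edb))
  have h2 := Nat.right_le_pair (Encodable.encode R.head)
    (Nat.pair (Encodable.encode R.idb) (Encodable.encode R.edb))
  have h3 := Nat.left_le_pair (Encodable.encode R.idb) (Encodable.encode R.edb)
  have h4 := Nat.right_le_pair (Encodable.encode R.idb) (Encodable.encode R.edb)
  refine ⟨Atom.boundedBy_of_encode_lt (by omega), (length_le_encode _).trans (by omega),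
    (length_le_encode _).trans (by omega), fun a ha => ?_, fun a ha => ?_⟩
  · have := encode_lt_of_mem ha
    exact Atom.boundedBy_of_encode_lt (by omega)
  · have := encode_lt_of_mem ha
    exact Atom.boundedBy_of_encode_lt (by omega)

/-- Provides a bound computable from the program: pairing dominates both components, so the code of
a list exceeds the codes of its members and is at least its length. -/
theorem Program.boundedBy_encode (Prog : Program ℕ) :
    Prog.BoundedBy (Encodable.encode Prog + 1) := fun _ hR =>
  Rule.boundedBy_of_encode_lt ((encode_lt_of_mem hR).trans (Nat.lt_succ_self _))

/-- The lists of length at most `n` with entries from `L`. -/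
def listsLE {α : Type*} (L : List α) : ℕ → List (List α)
  | 0 => [[]]
  | n + 1 => [] :: L.flatMap fun a => (listsLE L n).map fun l => a :: l

theorem mem_listsLE {α : Type*} {L : List α} {n : ℕ} {l : List α} :
    l ∈ listsLE L n ↔ l.length ≤ n ∧ ∀ a ∈ l, a ∈ L := by
  induction n generalizing l with
  | zero => cases l <;> simp [listsLE]
  | succ n ih =>
    cases l with
    | nil => simp [listsLE]
    | cons b l =>
      simp only [listsLE, List.mem_cons, reduceCtorEq, false_or, List.mem_flatMap, List.mem_map, ih,
        List.cons.injEq, List.length_cons, Nat.add_le_add_iff_right, forall_eq_or_imp]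
      constructor
      · rintro ⟨a, ha, l', ⟨h1, h2⟩, rfl, rfl⟩
        exact ⟨h1, ha, h2⟩
      · rintro ⟨h1, ha, h2⟩
        exact ⟨b, ha, l, ⟨h1, h2⟩, rfl, rfl⟩

/-- The tuples of length at most `m` with values at most `2 * m`. -/
def smallTuples (m : ℕ) : List (List ℕ) := listsLE (List.range (2 * m + 1)) m

/-- The facts with predicates below `m` and small tuples. -/
def smallFacts (m : ℕ) : List Fact :=
  (List.range m).flatMap fun p => (smallTuples m).map fun t => (p, t)

/-- The subsets of the set of small facts, as lists. -/
def smallDatabases (m : ℕ) : List (List Fact) := listsLE (smallFacts m) (smallFacts m).length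

theorem mem_smallTuples {m : ℕ} {t : List ℕ} :
    t ∈ smallTuples m ↔ t.length ≤ m ∧ ∀ v ∈ t, v < 2 * m + 1 := by
  simp [smallTuples, mem_listsLE]

theorem mem_smallFacts {m : ℕ} {f : Fact} :
    f ∈ smallFacts m ↔ f.1 < m ∧ f.2 ∈ smallTuples m := by
  obtain ⟨p, t⟩ := f
  simp [smallFacts]

theorem mem_smallDatabases_of_nodup {m : ℕ} {M : List Fact} (hM : M.Nodup)
    (h : ∀ f ∈ M, f ∈ smallFacts m) : M ∈ smallDatabases m :=
  mem_listsLE.2 ⟨(hM.subperm h).length_le, h⟩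

/-- The instance of the atom under the assignment given by a list. -/
def instFact (vs : List ℕ) (a : Atom ℕ) : Fact :=
  (a.pred, a.args.map (Term.ground fun x => vs.getD x 0))

/-- `M` is closed under the rules of the program over the database `D`, for assignments of small
values. -/
def IsModel (m : ℕ) (Prog : Program ℕ) (D M : List Fact) : Prop :=
  ∀ R ∈ Prog, ∀ vs ∈ smallTuples m, (∀ a ∈ R.idb, instFact vs a ∈ M) →
    (∀ a ∈ R.edb, instFact vs a ∈ D) → instFact vs R.head ∈ M

/-- The fact belongs to all models of the program over `D`. -/
def Entails (m : ℕ) (Prog : Program ℕ) (D : List Fact) (f : Fact) : Prop :=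
  ∀ M ∈ smallDatabases m, IsModel m Prog D M → f ∈ M

theorem instFact_mem_smallFacts {m : ℕ} {vs : List ℕ} (hvs : vs ∈ smallTuples m) {a : Atom ℕ}
    (ha : a.BoundedBy m) : instFact vs a ∈ smallFacts m := by
  refine mem_smallFacts.2 ⟨ha.pred, mem_smallTuples.2 ⟨by simpa [instFact] using ha.length, ?_⟩⟩
  intro v hv
  obtain ⟨s, hs, rfl⟩ := List.mem_map.1 hv
  cases s with
  | const c =>
    have := ha.const_lt hs
    simp only [Term.ground]
    omega
  | var x =>
    simp only [Term.ground]
    rw [List.getD_eq_getElem?_getD]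
    rcases hx : vs[x]? with _ | w
    · simp
    · simpa using (mem_smallTuples.1 hvs).2 w (List.mem_of_getElem? hx)

/-- The derivable small facts themselves form one of the models searched. -/
theorem Entails.derives {m : ℕ} {Prog : Program ℕ} (hB : Prog.BoundedBy m) {D : List Fact}
    {q : ℕ} {t : List ℕ} (h : Entails m Prog D (q, t)) : Derives Prog D.toFinset q t := by
  classical
  have key := h ((smallFacts m).filter fun f => Derives Prog D.toFinset f.1 f.2)
    (mem_listsLE.2 ⟨List.length_filter_le _ _, fun f hf => (List.mem_filter.1 hf).1⟩) ?_
  · simpa using (List.mem_filter.1 key).2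
  · intro R hR vs hvs hidb hedb
    refine List.mem_filter.2 ⟨instFact_mem_smallFacts hvs (hB R hR).head, ?_⟩
    simp only [decide_eq_true_eq]
    exact Derives.rule R hR _ (fun a ha => of_decide_eq_true (List.mem_filter.1 (hidb a ha)).2)
      fun a ha => List.mem_toFinset.2 (hedb a ha)

/-- A model contains all derivable facts. Models are tested only on small assignments, which
suffices by safety: head variables occur in the body, and the body facts are small. -/
theorem Derives.entails {m : ℕ} {Prog : Program ℕ} (hsafe : Prog.Safe) (hB : Prog.BoundedBy m)
    {D : List Fact} (hD : ∀ f ∈ D, f ∈ smallFacts m) {q : ℕ} {t : List ℕ}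
    (h : Derives Prog D.toFinset q t) : Entails m Prog D (q, t) := by
  intro M hM hmod
  have hMs := (mem_listsLE.1 hM).2
  induction h with
  | rule R hR θ hidb hedb ih =>
    have hb := hB R hR
    -- Only the first `m` variables can occur in the rule. A value that is too large is replaced by
    -- 0, since its variable occurs in no body atom and hence not in the head.
    let vs := (List.range m).map fun x => if θ x < 2 * m + 1 then θ x else 0
    have hvs : vs ∈ smallTuples m := by
      refine mem_smallTuples.2 ⟨by simp [vs], fun v hv => ?_⟩
      obtain ⟨x, -, rfl⟩ := List.mem_map.1 hv
      split_ifs <;> omega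
    have hget : ∀ x < m, θ x < 2 * m + 1 → vs.getD x 0 = θ x := by
      intro x hx hθ
      rw [List.getD_eq_getElem?_getD]
      simp only [vs, List.getElem?_map, List.getElem?_range hx, Option.map_some,
        Option.getD_some, if_pos hθ]
    have hsmall : ∀ f ∈ smallFacts m, ∀ v ∈ f.2, v < 2 * m + 1 := fun f hf =>
      (mem_smallTuples.1 (mem_smallFacts.1 hf).2).2
    have hvar : ∀ a : Atom ℕ, (a.pred, a.args.map (Term.ground θ)) ∈ smallFacts m →
        a.BoundedBy m → ∀ x, Term.var x ∈ a.args → vs.getD x 0 = θ x := fun a ha hab x hx =>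
      hget x (hab.args _ hx) (hsmall _ ha _ (List.mem_map.2 ⟨_, hx, rfl⟩))
    have hinst : ∀ a : Atom ℕ, (∀ x, Term.var x ∈ a.args → vs.getD x 0 = θ x) →
        instFact vs a = (a.pred, a.args.map (Term.ground θ)) := fun a ha => by
      rw [instFact, map_ground_congr ha]
    have hedbD : ∀ a ∈ R.edb, (a.pred, a.args.map (Term.ground θ)) ∈ D := fun a ha =>
      List.mem_toFinset.1 (hedb a ha)
    have hheadv : ∀ x, Term.var x ∈ R.head.args → vs.getD x 0 = θ x := by
      intro x hx
      rcases (hsafe R hR).exists_atom hx with ⟨a, ha, hxa⟩ | ⟨a, ha, hxa⟩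
      · exact hvar a (hMs _ (ih a ha)) (hb.idb a ha) x hxa
      · exact hvar a (hD _ (hedbD a ha)) (hb.edb a ha) x hxa
    rw [← hinst R.head hheadv]
    refine hmod R hR vs hvs (fun a ha => ?_) (fun a ha => ?_)
    · rw [hinst a (hvar a (hMs _ (ih a ha)) (hb.idb a ha))]
      exact ih a ha
    · rw [hinst a (hvar a (hD _ (hedbD a ha)) (hb.edb a ha))]
      exact hedbD a ha

/-- The finite counterpart of `NeedsWidth`, with small databases and tuples. -/
def NeedsWidthSmall (m : ℕ) (Prog : Program ℕ) (q w : ℕ) : Prop :=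
  ∃ D ∈ smallDatabases m, ∃ t ∈ smallTuples m, Entails m Prog D (q, t) ∧
    ∀ C ∈ listsLE D w, C.length < w → ∃ v ∈ t, m ≤ v ∧ ∀ f ∈ C, v ∉ f.2

theorem NeedsWidthSmall.needsWidth {m : ℕ} {Prog : Program ℕ} (hB : Prog.BoundedBy m) {q w : ℕ}
    (h : NeedsWidthSmall m Prog q w) : NeedsWidth Prog m q w := by
  obtain ⟨D, hD, t, ht, hent, hC⟩ := h
  refine ⟨D.toFinset, t, hent.derives hB, fun C hCD hcov => ?_⟩
  by_contra! hlt
  obtain ⟨v, hv, hmv, hno⟩ := hC C.toList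
    (mem_listsLE.2 ⟨by simpa using hlt.le, fun f hf => List.mem_toFinset.1 (hCD (by simpa using hf))⟩)
    (by simpa using hlt)
  obtain ⟨f, hf, hvf⟩ := hcov v hv hmv
  exact hno f (by simpa using hf) hvf

theorem Derives.length_le {m : ℕ} {Prog : Program ℕ} (hB : Prog.BoundedBy m) {D : Database}
    {q : ℕ} {t : List ℕ} (h : Derives Prog D q t) : t.length ≤ m := by
  obtain ⟨R, hR, -, θ, rfl, -⟩ := h.exists_rule
  simpa using (hB R hR).head.length

/-- Values below `m` must stay fixed for the program, and the remaining values of `t` must stay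
distinguishable for covers. All other values may be merged. -/
theorem NeedsWidth.small {m : ℕ} {Prog : Program ℕ} (hsafe : Prog.Safe) (hB : Prog.BoundedBy m)
    {q w : ℕ} (h : NeedsWidth Prog m q w) : NeedsWidthSmall m Prog q w := by
  classical
  obtain ⟨D, t, hd, hC⟩ := h
  have htl := hd.length_le hB
  -- As `t` has at most `m` entries, its large values occupy `m` up to `2 * m - 1`, leaving `2 * m`
  -- for the rest.
  let g : ℕ → ℕ := fun v => if v < m then v else if v ∈ t then m + t.idxOf v else 2 * m
  have hidx : ∀ v ∈ t, t.idxOf v < m := fun v hv => (List.idxOf_lt_length_iff.2 hv).trans_le htl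
  have hg : ∀ v, g v < 2 * m + 1 := by
    intro v
    simp only [g]
    split_ifs with h1 h2
    · omega
    · have := hidx v h2
      omega
    · omega
  -- Stronger than injectivity on `t`: no value of the database outside `t` is merged with a large
  -- value of `t`. Hence covers pull back along `g` without growing.
  have hginj : ∀ v ∈ t, m ≤ v → ∀ u, g u = g v → u = v := by
    intro v hv hmv u huv
    have h1 := hidx v hv
    simp only [g, if_neg hmv.not_gt, if_pos hv] at huv
    split_ifs at huv with h2 h3
    · omega
    · exact (List.idxOf_inj h3).1 (by omega)
    · omega
  let D' : Database := (D.filter fun f => f.1 < m ∧ f.2.length ≤ m).image fun f => (f.1, f.2.map g)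
  have hD' : ∀ f ∈ D'.toList, f ∈ smallFacts m := by
    intro f hf
    obtain ⟨f', hf', rfl⟩ := Finset.mem_image.1 (Finset.mem_toList.1 hf)
    obtain ⟨-, h1, h2⟩ := Finset.mem_filter.1 hf'
    refine mem_smallFacts.2 ⟨h1, mem_smallTuples.2 ⟨by simpa using h2, fun v hv => ?_⟩⟩
    obtain ⟨u, -, rfl⟩ := List.mem_map.1 hv
    exact hg u
  have hder : Derives Prog D'.toList.toFinset q (t.map g) := by
    refine hd.map hB (fun c hc => if_pos hc) fun f hf h1 h2 => ?_
    rw [Finset.toList_toFinset]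
    exact Finset.mem_image_of_mem (fun f : Fact => (f.1, f.2.map g))
      (Finset.mem_filter.2 ⟨hf, h1, h2⟩)
  refine ⟨D'.toList, mem_smallDatabases_of_nodup (Finset.nodup_toList _) hD', t.map g,
    mem_smallTuples.2 ⟨by simpa using htl, fun v hv => ?_⟩, hder.entails hsafe hB hD', ?_⟩
  · obtain ⟨u, -, rfl⟩ := List.mem_map.1 hv
    exact hg u
  · intro C hCD hlt
    by_contra! hcov
    have hpre : ∀ f ∈ C, ∃ f' ∈ D, f'.2.map g = f.2 := by
      intro f hf
      obtain ⟨f', hf', rfl⟩ :=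
        Finset.mem_image.1 (Finset.mem_toList.1 ((mem_listsLE.1 hCD).2 f hf))
      exact ⟨f', (Finset.mem_filter.1 hf').1, rfl⟩
    choose! F hFD hF using hpre
    have := hC (C.toFinset.image F) ?_ ?_
    · have h1 := Finset.card_image_le (s := C.toFinset) (f := F)
      have h2 := List.toFinset_card_le C
      omega
    · intro f hf
      obtain ⟨f', hf', rfl⟩ := Finset.mem_image.1 hf
      exact hFD f' (List.mem_toFinset.1 hf')
    · intro v hv hmv
      have hmg : m ≤ g v := by simp [g, hmv.not_gt, hv]
      obtain ⟨f, hf, hvf⟩ := hcov (g v) (List.mem_map_of_mem hv) hmg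
      rw [← hF f hf] at hvf
      obtain ⟨u, hu, huv⟩ := List.mem_map.1 hvf
      exact ⟨F f, Finset.mem_image_of_mem _ (List.mem_toFinset.2 hf), hginj v hv hmv u huv ▸ hu⟩

/-- One fact per value of the tuple suffices once any cover exists, and tuples have length at most
`m`. This limits the search range of `minWidth`. -/
theorem NeedsWidth.le {m : ℕ} {Prog : Program ℕ} (hB : Prog.BoundedBy m)
    {Other : AdornedProgram} (hO : AdornedProgram.EDBBounded Other) (hE : Equivalent Prog Other)
    {q w : ℕ} (hq : Prog.IsIDB q) (h : NeedsWidth Prog m q w) : w ≤ m := by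
  classical
  obtain ⟨D, t, hd, hC⟩ := h
  obtain ⟨C, hCD, -, hcov⟩ := exists_cover_of_derives hB hO hE hq hd
  choose! F hF hF' using hcov
  refine (hC ((t.toFinset.filter fun v => m ≤ v).image F) ?_ ?_).trans ?_
  · intro f hf
    obtain ⟨v, hv, rfl⟩ := Finset.mem_image.1 hf
    obtain ⟨h1, h2⟩ := Finset.mem_filter.1 hv
    exact hCD (hF v (List.mem_toFinset.1 h1) h2)
  · exact fun v hv hmv => ⟨F v, Finset.mem_image_of_mem _
      (Finset.mem_filter.2 ⟨List.mem_toFinset.2 hv, hmv⟩), hF' v hv hmv⟩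
  · exact Finset.card_image_le.trans ((Finset.card_filter_le _ _).trans
      ((List.toFinset_card_le t).trans (hd.length_le hB)))

open Classical in
/-- The minimal width, found by a finite search. -/
noncomputable def minWidth (p : Program ℕ × ℕ) : ℕ :=
  Nat.findGreatest (fun w => NeedsWidthSmall (Encodable.encode p.1 + 1) p.1 p.2 w)
    (Encodable.encode p.1 + 1)

/-- The width of the output is needed and bounds every needed width. The value 0 is treated apart on
both sides: it is the default of `Nat.findGreatest`, and it is the width when no rule is headed by
`q`. -/
theorem IsOutput.minWidth_eq {Prog : Program ℕ} (hsafe : Prog.Safe) {Out : AdornedProgram}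
    (h : IsOutput Prog Out) {q : ℕ} (hq : Prog.IsIDB q) :
    minWidth (Prog, q) = AdornedProgram.ew Out q := by
  classical
  have hB := Prog.boundedBy_encode
  have hreach : Reachable Prog Out := h.1
  have hO := hreach.edbBounded hsafe
  have hE := h.equivalent hsafe
  refine le_antisymm ?_ ?_
  · by_cases h0 : minWidth (Prog, q) = 0
    · simp [h0]
    · exact ((Nat.findGreatest_of_ne_zero (rfl : minWidth (Prog, q) = _) h0).needsWidth hB).le_ew
        hB hO hE hq
  · by_cases h0 : AdornedProgram.ew Out q = 0
    · simp [h0]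
    · have hn := hreach.needsWidth hB h0
      exact Nat.le_findGreatest (hn.le hB hO hE hq) (hn.small hsafe hB)

/-! ### Computability of the search -/

section Primrec

variable {α β : Type*} [Primcodable α] [Primcodable β]

theorem primrecPred_forall_mem {f : α → List β} {p : α → β → Prop} (hf : Primrec f)
    (hp : PrimrecRel p) : PrimrecPred fun a => ∀ b ∈ f a, p a b :=
  hp.swap.forall_mem_list.comp hf .id

theorem primrecPred_exists_mem {f : α → List β} {p : α → β → Prop} (hf : Primrec f)
    (hp : PrimrecRel p) : PrimrecPred fun a => ∃ b ∈ f a, p a b :=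
  hp.swap.exists_mem_list.comp hf .id

theorem primrecPred_mem {f : α → List β} {g : α → β} (hf : Primrec f) (hg : Primrec g) :
    PrimrecPred fun a => g a ∈ f a := by
  classical
  refine (primrecPred_exists_mem (p := fun a b => b = g a) hf ?_).of_eq fun a => by simp
  exact Primrec.eq.comp Primrec.snd (hg.comp Primrec.fst)

theorem PrimrecPred.imp {p q : α → Prop} (hp : PrimrecPred p) (hq : PrimrecPred q) :
    PrimrecPred fun a => p a → q a :=
  (hp.not.or hq).of_eq fun _ => by tauto

theorem primrec_listsLE {f : α → List β} {g : α → ℕ} (hf : Primrec f) (hg : Primrec g) :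
    Primrec fun a => listsLE (f a) (g a) := by
  have h : Primrec₂ fun (a : α) (p : ℕ × List (List β)) =>
      ([] : List β) :: (f a).flatMap fun b => p.2.map fun l => b :: l := by
    refine Primrec.list_cons.comp (Primrec.const _) (Primrec.list_flatMap (hf.comp Primrec.fst) ?_)
    refine Primrec.list_map (Primrec.snd.comp (Primrec.snd.comp Primrec.fst)) ?_
    exact Primrec.list_cons.comp (Primrec.snd.comp Primrec.fst) Primrec.snd
  refine (Primrec.nat_rec' hg (Primrec.const [[]]) h).of_eq fun a => ?_
  induction g a with
  | zero => rfl
  | succ n ih => simp only [listsLE, ← ih]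

theorem primrec_smallTuples {g : α → ℕ} (hg : Primrec g) : Primrec fun a => smallTuples (g a) :=
  primrec_listsLE (Primrec.list_range.comp
    (Primrec.succ.comp (Primrec.nat_mul.comp (Primrec.const 2) hg))) hg

theorem primrec_smallFacts {g : α → ℕ} (hg : Primrec g) : Primrec fun a => smallFacts (g a) := by
  refine Primrec.list_flatMap (Primrec.list_range.comp hg) ?_
  refine Primrec.list_map (primrec_smallTuples (hg.comp Primrec.fst)) ?_
  exact Primrec.pair (Primrec.snd.comp Primrec.fst) Primrec.snd

theorem primrec_smallDatabases {g : α → ℕ} (hg : Primrec g) :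
    Primrec fun a => smallDatabases (g a) :=
  primrec_listsLE (primrec_smallFacts hg) (Primrec.list_length.comp (primrec_smallFacts hg))

theorem primrec_atom_equivProd : Primrec (Atom.equivProd ℕ) := Primrec.of_equiv

theorem primrec_rule_equivProd : Primrec (Rule.equivProd ℕ) := Primrec.of_equiv

theorem primrec_term_equivSum : Primrec Term.equivSum := Primrec.of_equiv

theorem primrec_ground : Primrec₂ fun (vs : List ℕ) (t : Term) =>
    t.ground fun x => vs.getD x 0 := by
  have h : Primrec fun p : List ℕ × Term => (Sum.casesOn (Term.equivSum p.2)
      (fun x => p.1.getD x 0) (fun c => c) : ℕ) := by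
    refine Primrec.sumCasesOn (primrec_term_equivSum.comp Primrec.snd) ?_ Primrec.snd
    exact (Primrec.list_getD 0).comp (Primrec.fst.comp Primrec.fst) Primrec.snd
  refine h.of_eq ?_
  rintro ⟨vs, x | c⟩ <;> rfl

theorem primrec_instFact {f : α → List ℕ} {g : α → Atom ℕ} (hf : Primrec f) (hg : Primrec g) :
    Primrec fun a => instFact (f a) (g a) := by
  have h := primrec_atom_equivProd.comp hg
  refine Primrec.pair (Primrec.fst.comp h) (Primrec.list_map (Primrec.snd.comp h) ?_)
  exact primrec_ground.comp (hf.comp Primrec.fst) Primrec.snd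

theorem primrecPred_isModel {m : α → ℕ} {P : α → Program ℕ} {D M : α → List Fact} (hm : Primrec m)
    (hP : Primrec P) (hD : Primrec D) (hM : Primrec M) :
    PrimrecPred fun a => IsModel (m a) (P a) (D a) (M a) := by
  have hR : Primrec fun x : (α × Rule ℕ) × List ℕ => Rule.equivProd ℕ x.1.2 :=
    primrec_rule_equivProd.comp (Primrec.snd.comp Primrec.fst)
  have hα : Primrec fun x : (α × Rule ℕ) × List ℕ => x.1.1 := Primrec.fst.comp Primrec.fst
  refine primrecPred_forall_mem hP (primrecPred_forall_mem
    (primrec_smallTuples (hm.comp Primrec.fst)) ?_)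
  refine PrimrecPred.imp (primrecPred_forall_mem (Primrec.fst.comp (Primrec.snd.comp hR)) ?_)
    (PrimrecPred.imp (primrecPred_forall_mem (Primrec.snd.comp (Primrec.snd.comp hR)) ?_) ?_)
  · exact primrecPred_mem (hM.comp (hα.comp Primrec.fst))
      (primrec_instFact (Primrec.snd.comp Primrec.fst) Primrec.snd)
  · exact primrecPred_mem (hD.comp (hα.comp Primrec.fst))
      (primrec_instFact (Primrec.snd.comp Primrec.fst) Primrec.snd)
  · exact primrecPred_mem (hM.comp hα) (primrec_instFact Primrec.snd (Primrec.fst.comp hR))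

theorem primrecPred_entails {m : α → ℕ} {P : α → Program ℕ} {D : α → List Fact} {f : α → Fact}
    (hm : Primrec m) (hP : Primrec P) (hD : Primrec D) (hf : Primrec f) :
    PrimrecPred fun a => Entails (m a) (P a) (D a) (f a) := by
  refine primrecPred_forall_mem (primrec_smallDatabases hm) (PrimrecPred.imp ?_ ?_)
  · exact primrecPred_isModel (hm.comp Primrec.fst) (hP.comp Primrec.fst) (hD.comp Primrec.fst)
      Primrec.snd
  · exact primrecPred_mem Primrec.snd (hf.comp Primrec.fst)

/-- Every quantifier ranges over an explicit, primitive recursively computed list, so bounded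
quantification suffices throughout. -/
theorem primrecPred_needsWidthSmall {m : α → ℕ} {P : α → Program ℕ} {q w : α → ℕ}
    (hm : Primrec m) (hP : Primrec P) (hq : Primrec q) (hw : Primrec w) :
    PrimrecPred fun a => NeedsWidthSmall (m a) (P a) (q a) (w a) := by
  have hα : Primrec fun x : (α × List Fact) × List ℕ => x.1.1 := Primrec.fst.comp Primrec.fst
  have hD : Primrec fun x : (α × List Fact) × List ℕ => x.1.2 := Primrec.snd.comp Primrec.fst
  refine primrecPred_exists_mem (primrec_smallDatabases hm) (primrecPred_exists_mem
    (primrec_smallTuples (hm.comp Primrec.fst)) (PrimrecPred.and ?_ ?_))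
  · exact primrecPred_entails (hm.comp hα) (hP.comp hα) hD
      (Primrec.pair (hq.comp hα) Primrec.snd)
  · refine primrecPred_forall_mem (primrec_listsLE hD (hw.comp hα)) (PrimrecPred.imp ?_ ?_)
    · exact Primrec.nat_lt.comp (Primrec.list_length.comp Primrec.snd)
        (hw.comp (hα.comp Primrec.fst))
    · refine primrecPred_exists_mem (Primrec.snd.comp Primrec.fst) (PrimrecPred.and ?_ ?_)
      · exact Primrec.nat_le.comp (hm.comp (hα.comp (Primrec.fst.comp Primrec.fst))) Primrec.snd
      · refine primrecPred_forall_mem (Primrec.snd.comp Primrec.fst) (PrimrecPred.not ?_)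
        exact primrecPred_mem (Primrec.snd.comp Primrec.snd) (Primrec.snd.comp Primrec.fst)

end Primrec

theorem primrec_minWidth : Primrec minWidth := by
  classical
  have hm : Primrec fun p : Program ℕ × ℕ => Encodable.encode p.1 + 1 :=
    Primrec.succ.comp (Primrec.encode.comp Primrec.fst)
  exact Primrec.nat_findGreatest hm (primrecPred_needsWidthSmall (hm.comp Primrec.fst)
    (Primrec.fst.comp Primrec.fst) (Primrec.snd.comp Primrec.fst) Primrec.snd)

end Datalog

theorem mainTheorem2 :
    (∀ Prog : Datalog.Program ℕ, Prog.Safe →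
      (∃ Out : Datalog.AdornedProgram, Datalog.IsOutput Prog Out) ∧
      ∀ Out : Datalog.AdornedProgram, Datalog.IsOutput Prog Out →
        Datalog.AdornedProgram.EDBBounded Out ∧ Datalog.Equivalent Prog Out ∧
        ∀ q : ℕ, Prog.IsIDB q →
          ∀ Other : Datalog.AdornedProgram,
            Datalog.AdornedProgram.EDBBounded Other → Datalog.Equivalent Prog Other →
              Datalog.AdornedProgram.ew Out q ≤ Datalog.AdornedProgram.ew Other q) ∧
    ∃ width : Datalog.Program ℕ × ℕ → ℕ, Computable width ∧
      ∀ (Prog : Datalog.Program ℕ) (q : ℕ), Prog.Safe → Prog.IsIDB q →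
        IsLeast {w : ℕ | ∃ Other : Datalog.AdornedProgram,
            Datalog.AdornedProgram.EDBBounded Other ∧ Datalog.Equivalent Prog Other ∧
              Datalog.AdornedProgram.ew Other q = w}
          (width (Prog, q)) := by
  have hmin : ∀ Prog : Datalog.Program ℕ, ∀ Out : Datalog.AdornedProgram,
      Datalog.IsOutput Prog Out → ∀ q : ℕ, Prog.IsIDB q → ∀ Other : Datalog.AdornedProgram,
        Datalog.AdornedProgram.EDBBounded Other → Datalog.Equivalent Prog Other →
          Datalog.AdornedProgram.ew Out q ≤ Datalog.AdornedProgram.ew Other q := by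
    intro Prog Out hout q hq Other hO hE
    -- A nonzero width is attained by an adornment, which the canonical database argument requires.
    by_cases h0 : Datalog.AdornedProgram.ew Out q = 0
    · simp [h0]
    · exact (Datalog.Reachable.needsWidth Prog.boundedBy_encode hout.1 h0).le_ew
        Prog.boundedBy_encode hO hE hq
  refine ⟨fun Prog hsafe => ⟨Datalog.exists_isOutput Prog.boundedBy_encode, fun Out hout =>
    ⟨Datalog.Reachable.edbBounded hsafe hout.1, hout.equivalent hsafe, hmin Prog Out hout⟩⟩,
    Datalog.minWidth, Datalog.primrec_minWidth.to_comp, fun Prog q hsafe hq => ?_⟩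
  obtain ⟨Out, hout⟩ := Datalog.exists_isOutput Prog.boundedBy_encode
  rw [hout.minWidth_eq hsafe hq]
  -- The output is itself one of the competing programs, so the minimum is attained.
  refine ⟨⟨Out, Datalog.Reachable.edbBounded hsafe hout.1, hout.equivalent hsafe, rfl⟩, ?_⟩
  rintro w ⟨Other, hO, hE, rfl⟩
  exact hmin Prog Out hout q hq Other hO hE
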